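/- All rings are finite, commutative and with identity. A \emph{Galois ring} is a local ring $S$ of characteristic $p^n$ ($p$ prime, $n\ge 1$) with $\mathrm{rad}(S)=pS$. A \emph{CG-ring} is a direct product of Galois rings of pairwise coprime characteristics. A \emph{Schur ring} (S-ring) over a finite abelian group $G$ is a subring $\mathcal A$ of the group ring $\mathbb Z G$ that has a $\mathbb Z$-basis of elements $\xi(X)=\sum_{x\in X}x$, where $X$ runs over a family $\mathcal S(\mathcal A)$ of pairwise disjoint non-empty subsets of $G$ (the \emph{basic sets}) which covers $G$, contains $\{0_G\}$ and is closed under $X\mapsto -X$. Its rank is $\mathrm{rk}_{\mathbb Z}(\mathcal A)$. An S-ring \emph{over a ring} $R$ is an S-ring $\mathcal A$ over the additive group $R^+$ such that $uX\in\mathcal S(\mathcal A)$ for all $u\in R^\times$, $X\in\mathcal S(\mathcal A)$; it is \emph{rational} if $uX=X$ for all such $u$ and $X$. An \emph{$\mathcal A$-ideal} is an ideal of $R$ that is a union of basic sets. For $X\subseteq R$ let $I_L(X)$ be the largest ideal $I$ of $R$ with $X+I=X$. $\mathcal A$ is a \emph{non-trivial generalized wreath product} if there are $\mathcal A$-ideals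 $I\ne R$ and $J\ne 0$ such that $J\subseteq I_L(X)\cap I$ for every $X\in\mathcal S(\mathcal A)$ with $X\subseteq R\setminus I$. $\mathcal A$ is the \emph{tensor product} of $\mathcal A_1$ and $\mathcal A_2$ if $R=I_1\oplus I_2$ for ideals $I_1,I_2$, $\mathcal A_i$ is an S-ring over the ring $I_i$ ($i=1,2$; the identity of $I_i$ is the $I_i$-component of $1$), and $\mathcal A$ is the subring $\mathcal A_1\otimes\mathcal A_2$ of $\mathbb Z I_1^+\otimes\mathbb Z I_2^+=\mathbb Z R^+$, so that $\mathcal S(\mathcal A)=\{X_1+X_2:\ X_1\in\mathcal S(\mathcal A_1),\ X_2\in\mathcal S(\mathcal A_2)\}$. (Here $I_i=0$ is allowed.) \textbf{Theorem.} Let $R$ be a non-zero CG-ring and $\mathcal A$ a rational S-ring over $R$. Then $\mathcal A$ is a non-trivial generalized wreath product, or $\mathcal A$ is a tensor product of two S-rings one of which has rank $2$ (or both). -/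

import Mathlib

open scoped Pointwise

/-- The element `ξ(X) = ∑_{x ∈ X} x` of the group ring `ℤG`, for `X ⊆ G`. -/
noncomputable def setSum {G : Type*} [Finite G] (X : Set G) : AddMonoidAlgebra ℤ G :=
  ∑ x ∈ X.toFinite.toFinset, AddMonoidAlgebra.single x 1

theorem setSum_apply {G : Type*} [Finite G] (X : Set G) (g : G) [Decidable (g ∈ X)] :
    (setSum X).coeff g = if g ∈ X then 1 else 0 := by
  classical
  unfold setSum
  rw [AddMonoidAlgebra.coeff_sum, Finsupp.finsetSum_apply]
  simp [Finsupp.single_apply]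

/-- A Schur ring over a finite abelian group `G` (written additively): a subring (that is, a
`ℤ`-subalgebra) of the group ring `ℤG` having a `ℤ`-basis of the elements `ξ(X)`, where `X` runs
over a family `basicSets` of non-empty pairwise disjoint sets which contains `{0}`, covers `G`
and is closed under negation. -/
@[ext]
structure SchurRing (G : Type*) [AddCommGroup G] [Finite G] where
  toSubalgebra : Subalgebra ℤ (AddMonoidAlgebra ℤ G)
  basicSets : Set (Set G)
  nonempty_of_mem : ∀ X ∈ basicSets, X.Nonempty
  pairwiseDisjoint : basicSets.PairwiseDisjoint id
  singleton_zero_mem : {0} ∈ basicSets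
  sUnion_eq : ⋃₀ basicSets = Set.univ
  neg_mem : ∀ X ∈ basicSets, -X ∈ basicSets
  linearIndepOn : LinearIndepOn ℤ setSum basicSets
  span_eq : Submodule.span ℤ (setSum '' basicSets) = Subalgebra.toSubmodule toSubalgebra

/-- Sums over pairwise disjoint non-empty sets are linearly independent. -/
theorem linearIndepOn_setSum {G : Type*} [Finite G] {S : Set (Set G)}
    (hne : ∀ X ∈ S, X.Nonempty) (hd : S.PairwiseDisjoint id) : LinearIndepOn ℤ setSum S := by
  classical
  rw [LinearIndepOn, linearIndependent_iff']
  intro s c hc X hX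
  obtain ⟨g, hg⟩ := hne X X.2
  have h := congrArg (fun f : AddMonoidAlgebra ℤ G => f.coeff g) hc
  simp only [AddMonoidAlgebra.coeff_sum, Finsupp.finsetSum_apply] at h
  rw [Finset.sum_eq_single X] at h
  · simpa [setSum_apply, hg] using h
  · intro Y _ hYX
    have : g ∉ (Y : Set G) := fun hgY =>
      Set.disjoint_left.1 (hd Y.2 X.2 (fun h => hYX (Subtype.ext h))) hgY hg
    simp [setSum_apply, this]
  · intro h; exact absurd hX h

theorem setSum_image_prod {G G₁ G₂ : Type*} [AddCommGroup G] [Finite G] [AddCommGroup G₁]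
    [Finite G₁] [AddCommGroup G₂] [Finite G₂] (e : (G₁ × G₂) ≃+ G) (X₁ : Set G₁) (X₂ : Set G₂) :
    AddMonoidAlgebra.mapDomainAlgHom ℤ ℤ (e.toAddMonoidHom.comp (AddMonoidHom.inl G₁ G₂))
        (setSum X₁) *
      AddMonoidAlgebra.mapDomainAlgHom ℤ ℤ (e.toAddMonoidHom.comp (AddMonoidHom.inr G₁ G₂))
        (setSum X₂) = setSum (e '' (X₁ ×ˢ X₂)) := by
  classical
  have h : (e '' (X₁ ×ˢ X₂)).toFinite.toFinset =
      (X₁.toFinite.toFinset ×ˢ X₂.toFinite.toFinset).map e.toEquiv.toEmbedding := by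
    ext g
    obtain ⟨y, rfl⟩ := e.surjective g
    simp
  have h' : setSum (e '' (X₁ ×ˢ X₂)) = ∑ y ∈ X₁.toFinite.toFinset ×ˢ X₂.toFinite.toFinset,
      AddMonoidAlgebra.single (e y) 1 := by
    rw [setSum, h, Finset.sum_map]; rfl
  rw [h', Finset.sum_product, setSum, setSum, map_sum, map_sum, Finset.sum_mul_sum]
  refine Finset.sum_congr rfl fun a _ => Finset.sum_congr rfl fun b _ => ?_
  simp [AddMonoidAlgebra.single_mul_single, ← map_add]

namespace SchurRing

/-- The rank of a Schur ring. -/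
noncomputable def rank {G : Type*} [AddCommGroup G] [Finite G] (A : SchurRing G) : ℕ :=
  Module.finrank ℤ A.toSubalgebra

/-- The `A`-sets: unions of basic sets of `A`. -/
def IsASet {G : Type*} [AddCommGroup G] [Finite G] (A : SchurRing G) (Y : Set G) : Prop :=
  ∃ T ⊆ A.basicSets, Y = ⋃₀ T

/-- The tensor product `A₁ ⊗ A₂` of Schur rings over `G₁` and `G₂`, as a Schur ring over the group
`G` identified with `G₁ × G₂` by `e`: the subring of `ℤG = ℤG₁ ⊗ ℤG₂` generated by `A₁` and `A₂`,
with basic sets `X₁ × X₂`. -/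
noncomputable def tensor {G G₁ G₂ : Type*} [AddCommGroup G] [Finite G] [AddCommGroup G₁]
    [Finite G₁] [AddCommGroup G₂] [Finite G₂] (e : (G₁ × G₂) ≃+ G)
    (A₁ : SchurRing G₁) (A₂ : SchurRing G₂) : SchurRing G where
  toSubalgebra :=
    A₁.toSubalgebra.map
        (AddMonoidAlgebra.mapDomainAlgHom ℤ ℤ (e.toAddMonoidHom.comp (AddMonoidHom.inl G₁ G₂))) ⊔
      A₂.toSubalgebra.map
        (AddMonoidAlgebra.mapDomainAlgHom ℤ ℤ (e.toAddMonoidHom.comp (AddMonoidHom.inr G₁ G₂)))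
  basicSets := {X | ∃ X₁ ∈ A₁.basicSets, ∃ X₂ ∈ A₂.basicSets, X = e '' (X₁ ×ˢ X₂)}
  nonempty_of_mem := by
    rintro _ ⟨X₁, h₁, X₂, h₂, rfl⟩
    exact ((A₁.nonempty_of_mem X₁ h₁).prod (A₂.nonempty_of_mem X₂ h₂)).image e
  pairwiseDisjoint := disj
  singleton_zero_mem := ⟨_, A₁.singleton_zero_mem, _, A₂.singleton_zero_mem, by
    rw [Set.singleton_prod_singleton, Set.image_singleton, Prod.mk_zero_zero, map_zero]⟩
  sUnion_eq := by
    refine Set.eq_univ_of_forall fun g => ?_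
    obtain ⟨X₁, h₁, m₁⟩ : (e.symm g).1 ∈ ⋃₀ A₁.basicSets := by rw [A₁.sUnion_eq]; trivial
    obtain ⟨X₂, h₂, m₂⟩ : (e.symm g).2 ∈ ⋃₀ A₂.basicSets := by rw [A₂.sUnion_eq]; trivial
    exact ⟨_, ⟨X₁, h₁, X₂, h₂, rfl⟩, e.symm g, ⟨m₁, m₂⟩, by simp⟩
  neg_mem := by
    rintro _ ⟨X₁, h₁, X₂, h₂, rfl⟩
    refine ⟨_, A₁.neg_mem _ h₁, _, A₂.neg_mem _ h₂, ?_⟩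
    ext g
    obtain ⟨y, rfl⟩ := e.surjective g
    rw [Set.mem_neg, ← map_neg, e.injective.mem_set_image, e.injective.mem_set_image]
    rfl
  linearIndepOn := by
    refine linearIndepOn_setSum ?_ disj
    rintro _ ⟨X₁, h₁, X₂, h₂, rfl⟩
    exact ((A₁.nonempty_of_mem X₁ h₁).prod (A₂.nonempty_of_mem X₂ h₂)).image e
  span_eq := by
    rw [← Subalgebra.mul_toSubmodule, Subalgebra.map_toSubmodule, Subalgebra.map_toSubmodule,
      ← A₁.span_eq, ← A₂.span_eq, Submodule.map_span, Submodule.map_span, Submodule.span_mul_span]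
    congr 1
    ext f
    simp only [Set.mem_image, Set.mem_ofPred_eq, Set.mem_mul]
    constructor
    · rintro ⟨_, ⟨X₁, h₁, X₂, h₂, rfl⟩, rfl⟩
      exact ⟨_, ⟨_, ⟨X₁, h₁, rfl⟩, rfl⟩, _, ⟨_, ⟨X₂, h₂, rfl⟩, rfl⟩, setSum_image_prod e X₁ X₂⟩
    · rintro ⟨_, ⟨_, ⟨X₁, h₁, rfl⟩, rfl⟩, _, ⟨_, ⟨X₂, h₂, rfl⟩, rfl⟩, rfl⟩
      exact ⟨_, ⟨X₁, h₁, X₂, h₂, rfl⟩, (setSum_image_prod e X₁ X₂).symm⟩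
where
  disj : Set.PairwiseDisjoint
      {X : Set G | ∃ X₁ ∈ A₁.basicSets, ∃ X₂ ∈ A₂.basicSets, X = e '' (X₁ ×ˢ X₂)} id := by
    rintro _ ⟨X₁, h₁, X₂, h₂, rfl⟩ _ ⟨Y₁, k₁, Y₂, k₂, rfl⟩ hne
    refine (Set.disjoint_image_iff e.injective).2 (Set.disjoint_prod.2 ?_)
    by_contra! hcon
    refine hne ?_
    rw [A₁.pairwiseDisjoint.elim h₁ k₁ hcon.1, A₂.pairwiseDisjoint.elim h₂ k₂ hcon.2]

/-- Invariance under the units of `R` of a Schur ring over the additive group of an `R`-module `M`.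
For `M = R` this says that `A` is a Schur ring over the ring `R`. For `M = I` an ideal which is a
direct summand of `R` (a ring with identity, each unit of which is the projection of a unit of `R`)
it says that `A` is a Schur ring over the ring `I`. -/
def IsUnitInvariant (R : Type*) {M : Type*} [CommRing R] [AddCommGroup M] [Module R M] [Finite M]
    (A : SchurRing M) : Prop :=
  ∀ u : Rˣ, ∀ X ∈ A.basicSets, u • X ∈ A.basicSets

/-- A Schur ring over the ring `R` is rational if all its basic sets are `Rˣ`-invariant. -/
def IsRational {R : Type*} [CommRing R] [Finite R] (A : SchurRing R) : Prop :=
  ∀ u : Rˣ, ∀ X ∈ A.basicSets, u • X = X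

end SchurRing

/-- `I_L(X)`: the largest ideal `I` of `R` such that `X + I = X` (see `isGreatest_lowerIdeal`). -/
noncomputable def lowerIdeal {R : Type*} [CommRing R] (X : Set R) : Ideal R :=
  sSup {I : Ideal R | X + (I : Set R) = X}

theorem isGreatest_lowerIdeal {R : Type*} [CommRing R] (X : Set R) :
    IsGreatest {I : Ideal R | X + (I : Set R) = X} (lowerIdeal X) := by
  refine ⟨?_, fun I hI => le_sSup hI⟩
  refine Set.Subset.antisymm ?_ fun x hx => ⟨x, hx, 0, zero_mem _, add_zero x⟩
  rintro _ ⟨x, hx, a, ha, rfl⟩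
  change x + a ∈ X
  rw [SetLike.mem_coe, lowerIdeal, sSup_eq_iSup', Submodule.mem_iSup_iff_exists_finsupp] at ha
  obtain ⟨f, hf, rfl⟩ := ha
  unfold Finsupp.sum
  generalize f.support = s
  classical
  induction s using Finset.induction_on with
  | empty => simpa using hx
  | insert i s hi ih =>
    rw [Finset.sum_insert hi, add_comm (f i), ← add_assoc]
    have h : X + ((i : Ideal R) : Set R) = X := i.2
    exact h.subset ⟨_, ih, f i, hf i, rfl⟩

namespace SchurRing

/-- `A` satisfies the `I/J`-condition: `I` and `J` are `A`-ideals, and `J ⊆ I_L(X) ∩ I` for every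
basic set `X` contained in `R \ I`. -/
def SatisfiesCondition {R : Type*} [CommRing R] [Finite R] (A : SchurRing R)
    (I J : Ideal R) : Prop :=
  A.IsASet (I : Set R) ∧ A.IsASet (J : Set R) ∧
    ∀ X ∈ A.basicSets, X ⊆ (I : Set R)ᶜ → J ≤ lowerIdeal X ⊓ I

/-- `A` is a non-trivial generalized wreath product. -/
def IsNontrivialGenWreath {R : Type*} [CommRing R] [Finite R] (A : SchurRing R) : Prop :=
  ∃ I J : Ideal R, I ≠ ⊤ ∧ J ≠ ⊥ ∧ A.SatisfiesCondition I J

/-- `A` is a tensor product of Schur rings over rings `I₁`, `I₂`, where `R = I₁ × I₂`,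
the first of which has rank `2`. -/
def IsTensorWithRankTwo {R : Type*} [CommRing R] [Finite R] (A : SchurRing R) : Prop :=
  ∃ (I₁ I₂ : Ideal R) (h : IsCompl I₁ I₂) (A₁ : SchurRing I₁) (A₂ : SchurRing I₂),
    A₁.IsUnitInvariant R ∧ A₂.IsUnitInvariant R ∧ A₁.rank = 2 ∧
      A = tensor (Submodule.prodEquivOfIsCompl I₁ I₂ h).toAddEquiv A₁ A₂

end SchurRing

/-- Galois rings: finite local commutative rings of characteristic `p ^ n`, where `p` is prime and
`n ≥ 1`, whose radical is generated by `p`. -/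
def IsGaloisRing (S : Type*) [CommRing S] : Prop :=
  Finite S ∧ IsLocalRing S ∧ ∃ p n : ℕ, p.Prime ∧ 0 < n ∧ CharP S (p ^ n) ∧
    Ideal.jacobson (⊥ : Ideal S) = Ideal.span {(p : S)}

/-- CG-rings: direct products of finitely many Galois rings of pairwise coprime characteristics. -/
def IsCGRing.{u} (R : Type u) [CommRing R] : Prop :=
  ∃ (k : ℕ) (S : Fin k → Type u) (_ : ∀ i, CommRing (S i)),
    (∀ i, IsGaloisRing (S i)) ∧
    (Pairwise fun i j => Nat.Coprime (ringChar (S i)) (ringChar (S j))) ∧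
    Nonempty (R ≃+* ∀ i, S i)

/-! In a CG-ring, elements of equal additive order are associated
(`IsCGRing.associated_of_addOrderOf_eq`), so by rationality membership in a basic set depends only
on the order. The rest is about finite abelian groups with a partition of this kind closed under
convolution (`IsSchurSetoid`).

The core is `IsSchurSetoid.rel_of_forall_mem_iff`: such a partition is determined by its saturated
subgroups. Restricting to the subgroup generated by a class, and inducting through the quotient by a
minimal saturated subgroup J, leaves two points x, u congruent modulo J. Suppose they are
inequivalent, and let p be a prime dividing |J|. By Schur's multiplier theorem the p'-elements over
which a class has multiplicity prime to p form a saturated set; it generates a subgroup of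
p'-elements, which therefore meets J trivially. Counting modulo p yields one such element z,
congruent to x and u modulo J and common to both classes' multiplicity sets. It lies in one of the
two classes, and that class is then contained in a proper saturated subgroup
(`exists_ne_top_of_sub_mem`).

Now let J be minimal and I the largest saturated subgroup not containing J, so that I ∩ J = 0. A
saturated subgroup through a point outside J + I contains J, so classes out there are J-invariant:
if J + I ≠ R, this is a generalized wreath product. If J + I = R, the orders in J and I are coprime,
every saturated subgroup splits, and the S-ring is a tensor product whose factor on J has rank 2. -/

theorem AddMonoidAlgebra.coeff_mul_eq_finsum {k G : Type*} [CommRing k] [AddCommGroup G] [Finite G]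
    (f g : AddMonoidAlgebra k G) (z : G) :
    (f * g).coeff z = ∑ᶠ a, f.coeff a * g.coeff (z - a) := by
  have := Fintype.ofFinite G
  rw [finsum_eq_sum_of_fintype, AddMonoidAlgebra.coeff_mul_apply_left,
    Finsupp.sum_fintype _ _ (by simp)]
  exact Finset.sum_congr rfl fun a _ => by rw [neg_add_eq_sub]

/-! ### Schur partitions, saturated sets and Schur's multiplier theorem. -/

/-- A Schur partition of a finite abelian group: an equivalence relation, coarser than equality of
orders, with `{0}` as a class, whose invariant functions are closed under convolution. -/
structure IsSchurSetoid {G : Type*} [AddCommGroup G] (r : Setoid G) : Prop where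
  eq_zero : ∀ x, r 0 x → x = 0
  of_addOrderOf_eq : ∀ x y, addOrderOf x = addOrderOf y → r x y
  conv : ∀ f g : G → ℤ, (∀ x y, r x y → f x = f y) → (∀ x y, r x y → g x = g y) →
    ∀ x y, r x y → ∑ᶠ a, f a * g (x - a) = ∑ᶠ a, f a * g (y - a)

/-- Saturation of a set under an equivalence relation. -/
def Setoid.IsSaturated {G : Type*} (r : Setoid G) (S : Set G) : Prop :=
  ∀ x y, r x y → x ∈ S → y ∈ S

namespace Setoid.IsSaturated

variable {G : Type*} {r : Setoid G} {S T : Set G}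

theorem mem_iff (hS : r.IsSaturated S) {x y : G} (h : r x y) : x ∈ S ↔ y ∈ S :=
  ⟨hS x y h, hS y x (r.symm' h)⟩

theorem inter (hS : r.IsSaturated S) (hT : r.IsSaturated T) : r.IsSaturated (S ∩ T) :=
  fun x y h hx => ⟨hS x y h hx.1, hT x y h hx.2⟩

end Setoid.IsSaturated

theorem Setoid.isSaturated_class {G : Type*} (r : Setoid G) (a : G) :
    r.IsSaturated {x | r a x} := fun _ _ h hx => r.trans' hx h

namespace IsSchurSetoid

variable {G : Type*} [AddCommGroup G] {r : Setoid G}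

theorem neg (hr : IsSchurSetoid r) (x : G) : r x (-x) := hr.of_addOrderOf_eq _ _ (by simp)

theorem isSaturated_bot (hr : IsSchurSetoid r) : r.IsSaturated ((⊥ : AddSubgroup G) : Set G) := by
  intro x y h hx
  have hx : x = 0 := hx
  subst hx
  exact hr.eq_zero _ h

theorem mem_of_addOrderOf_eq (hr : IsSchurSetoid r) {S : Set G} (hS : r.IsSaturated S) {x y : G}
    (h : addOrderOf x = addOrderOf y) (hx : x ∈ S) : y ∈ S :=
  hS x y (hr.of_addOrderOf_eq _ _ h) hx

variable [Finite G]

/-- Translates of a saturated set meet another one in a number of points that only depends on the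
class of the translation. -/
theorem ncard_conv (hr : IsSchurSetoid r) {S T : Set G} (hS : r.IsSaturated S)
    (hT : r.IsSaturated T) {x y : G} (h : r x y) :
    {a | a ∈ S ∧ x - a ∈ T}.ncard = {a | a ∈ S ∧ y - a ∈ T}.ncard := by
  classical
  have := Fintype.ofFinite G
  have key := hr.conv (fun a => if a ∈ S then 1 else 0) (fun a => if a ∈ T then 1 else 0)
    (fun x y h => by simp only [hS.mem_iff h]) (fun x y h => by simp only [hT.mem_iff h]) x y h
  rw [finsum_eq_sum_of_fintype, finsum_eq_sum_of_fintype] at key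
  simp only [← ite_and, mul_ite, mul_one, mul_zero, Finset.sum_boole] at key
  rw [Set.ncard_eq_toFinset_card', Set.ncard_eq_toFinset_card']
  have key' := Nat.cast_injective (R := ℤ) key
  convert key' using 2 <;> (ext a; simp [and_comm])

/-- The number of representations as a sum from S and T is constant on classes, so being positive is
too. -/
theorem isSaturated_add (hr : IsSchurSetoid r) {S T : Set G} (hS : r.IsSaturated S)
    (hT : r.IsSaturated T) : r.IsSaturated (S + T) := by
  rintro _ y h ⟨a, ha, b, hb, rfl⟩
  change r (a + b) y at h
  have h1 := hr.ncard_conv hS hT h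
  have h2 : {c | c ∈ S ∧ a + b - c ∈ T}.ncard ≠ 0 := by
    rw [← Nat.pos_iff_ne_zero, Set.ncard_pos]
    exact ⟨a, ha, by simpa using hb⟩
  rw [h1, ← Nat.pos_iff_ne_zero, Set.ncard_pos] at h2
  obtain ⟨c, hc, hc'⟩ := h2
  exact ⟨c, hc, _, hc', by simp⟩

theorem exists_add (hr : IsSchurSetoid r) {a b y : G} (h : r (a + b) y) :
    ∃ a' b', r a a' ∧ r b b' ∧ y = a' + b' := by
  obtain ⟨c, hc, d, hd, rfl⟩ := hr.isSaturated_add (r.isSaturated_class a) (r.isSaturated_class b)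
    _ _ h ⟨a, r.refl' a, b, r.refl' b, rfl⟩
  exact ⟨c, d, hc, hd, rfl⟩

theorem isSaturated_sup (hr : IsSchurSetoid r) {H K : AddSubgroup G}
    (hH : r.IsSaturated (H : Set G)) (hK : r.IsSaturated (K : Set G)) :
    r.IsSaturated ((H ⊔ K : AddSubgroup G) : Set G) := by
  rw [AddSubgroup.add_normal]
  exact hr.isSaturated_add hH hK

theorem isSaturated_closure (hr : IsSchurSetoid r) {S : Set G} (hS : r.IsSaturated S) :
    r.IsSaturated (AddSubgroup.closure S : Set G) := by
  intro x y h hx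
  rw [SetLike.mem_coe] at hx ⊢
  induction hx using AddSubgroup.closure_induction generalizing y with
  | mem x hx => exact AddSubgroup.subset_closure (hS _ _ h hx)
  | zero => rw [hr.eq_zero _ h]; exact zero_mem _
  | add a b _ _ iha ihb =>
    obtain ⟨a', b', ha, hb, rfl⟩ := hr.exists_add h
    exact add_mem (iha _ ha) (ihb _ hb)
  | neg a _ ih => exact ih _ (r.trans' (hr.neg a) h)

/-- The stabilizer of a saturated set under translations is saturated. -/
theorem isSaturated_stabilizer (hr : IsSchurSetoid r) {S : Set G} (hS : r.IsSaturated S) :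
    r.IsSaturated {g | ∀ x ∈ S, x + g ∈ S} := by
  -- Stabilizing S means attaining the largest possible count of representations in S + S (as S =
  -- -S), and that count is a class function.
  have key : ∀ g, (∀ x ∈ S, x + g ∈ S) ↔ {a | a ∈ S ∧ g - a ∈ S}.ncard = S.ncard := by
    intro g
    have : {a | a ∈ S ∧ g - a ∈ S} = {a ∈ S | a + -g ∈ S} := by
      ext a
      simp only [Set.mem_ofPred_eq]
      rw [show a + -g = -(g - a) by abel, hS.mem_iff (hr.neg (g - a))]
    have h2 : {a ∈ S | a + -g ∈ S}.ncard = S.ncard ↔ ∀ x ∈ S, x + -g ∈ S := by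
      constructor
      · intro h x hx
        have := Set.eq_of_subset_of_ncard_le (Set.sep_subset S _) h.ge
        rw [← this] at hx
        exact hx.2
      · intro h
        congr 1
        exact Set.sep_eq_self_iff_mem_true.2 h
    rw [this, h2]
    constructor <;> intro h x hx
    · have := h (-x) (hS _ _ (hr.neg x) hx)
      have := hS _ _ (hr.neg _) this
      simpa [add_comm] using this
    · have := h (-x) (hS _ _ (hr.neg x) hx)
      have := hS _ _ (hr.neg _) this
      simpa [add_comm] using this
  intro x y h hx
  rw [Set.mem_ofPred_eq, key] at hx ⊢
  rw [← hx, hr.ncard_conv hS hS h]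

/-- Schur's theorem on multipliers, for prime powers dividing the order. -/
theorem ncard_nsmul_modEq (hr : IsSchurSetoid r) {p : ℕ} (hp : p.Prime) (b : ℕ) {S : Set G}
    (hS : r.IsSaturated S) {x y : G} (h : r x y) :
    {a | a ∈ S ∧ p ^ b • a = x}.ncard ≡ {a | a ∈ S ∧ p ^ b • a = y}.ncard [MOD p] := by
  classical
  have := Fintype.ofFinite G
  have : Fact p.Prime := ⟨hp⟩
  have hmul : ∀ f g : AddMonoidAlgebra ℤ G, (∀ x y, r x y → f.coeff x = f.coeff y) →
      (∀ x y, r x y → g.coeff x = g.coeff y) →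
      ∀ x y, r x y → (f * g).coeff x = (f * g).coeff y := by
    intro f g hf hg x y h
    rw [AddMonoidAlgebra.coeff_mul_eq_finsum, AddMonoidAlgebra.coeff_mul_eq_finsum,
      hr.conv _ _ hf hg x y h]
  have hpow : ∀ n, ∀ x y, r x y → ((setSum S) ^ (n + 1)).coeff x = ((setSum S) ^ (n + 1)).coeff y := by
    intro n
    induction n with
    | zero =>
      intro x y h
      simp [setSum_apply, hS.mem_iff h]
    | succ n ih =>
      rw [pow_succ]
      exact hmul _ _ ih (fun x y h => by simp [setSum_apply, hS.mem_iff h])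
  have hcast : ∀ z, (((setSum S) ^ (p ^ b)).coeff z : ZMod p) =
      ({a | a ∈ S ∧ p ^ b • a = z}.ncard : ZMod p) := by
    intro z
    let φ : AddMonoidAlgebra ℤ G →+* AddMonoidAlgebra (ZMod p) G :=
      AddMonoidAlgebra.mapRingHom G (Int.castRingHom (ZMod p))
    have h1 : (((setSum S) ^ (p ^ b)).coeff z : ZMod p) = (φ ((setSum S) ^ (p ^ b))).coeff z := by
      simp only [φ, AddMonoidAlgebra.coeff_mapRingHom]
      rfl
    have : CharP (AddMonoidAlgebra (ZMod p) G) p :=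
      charP_of_injective_algebraMap' (ZMod p) p
    -- Frobenius: modulo p, the p^b-th power of ξ(S) is the sum of the elements p^b • a for a in S.
    rw [h1, map_pow, setSum, map_sum, sum_pow_char_pow]
    simp only [φ, AddMonoidAlgebra.mapRingHom_single, AddMonoidAlgebra.single_pow]
    simp [AddMonoidAlgebra.coeff_sum, Finsupp.finsetSum_apply, Finsupp.single_apply]
    rw [Set.ncard_eq_toFinset_card']
    congr 2
    ext a
    simp
  have hb : p ^ b = (p ^ b - 1) + 1 := (Nat.sub_add_cancel (Nat.one_le_pow _ _ hp.pos)).symm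
  rw [← ZMod.natCast_eq_natCast_iff, ← hcast, ← hcast, hb, hpow _ x y h]

end IsSchurSetoid

/-! ### Counting modulo p in sets that are closed under equality of orders. -/

section OrderClosed

variable {G : Type*} [AddCommGroup G]

/-- Some positive power of `p` acts on a finite abelian group as the projection onto the
complement of the `p`-primary component. -/
theorem exists_prime_pow_nsmul_nsmul_eq (G : Type*) [AddCommGroup G] [Finite G] {p : ℕ}
    (hp : p.Prime) : ∃ b ≠ 0, ∀ x : G, p ^ b • p ^ b • x = p ^ b • x := by
  obtain ⟨a, m, hm, hcard⟩ := Nat.exists_eq_pow_mul_and_not_dvd (n := Nat.card G)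
    Nat.card_pos.ne' p hp.ne_one
  have hm0 : 0 < m := Nat.pos_of_ne_zero fun h => hm (h ▸ dvd_zero p)
  have hφ : 0 < m.totient := Nat.totient_pos.2 hm0
  -- With this exponent P is 1 modulo m by Euler and divisible by p^a, hence |G| = p^a m divides (P
  -- - 1)P; the a + 1 keeps the exponent non-zero.
  refine ⟨(a + 1) * m.totient, by positivity, fun x => ?_⟩
  set P := p ^ ((a + 1) * m.totient) with hP
  have h1 : 1 ≤ P := Nat.one_le_pow _ _ hp.pos
  have h2 : m ∣ P - 1 := by
    rw [← Nat.modEq_iff_dvd' h1, hP, mul_comm, pow_mul]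
    have := (Nat.ModEq.pow_totient ((Nat.Prime.coprime_iff_not_dvd hp).2 hm)).pow (a + 1)
    rw [one_pow] at this
    exact this.symm
  have h3 : Nat.card G ∣ (P - 1) * P := by
    rw [hcard, mul_comm]
    exact mul_dvd_mul h2 (pow_dvd_pow _ (by nlinarith))
  have h4 : ((P - 1) * P) • x = 0 := by
    obtain ⟨c, hc⟩ := h3
    rw [hc, mul_comm, mul_nsmul', card_nsmul_eq_zero', nsmul_zero]
  have h5 : P * P = (P - 1) * P + P := by
    rw [← Nat.succ_mul, Nat.succ_eq_add_one, Nat.sub_add_cancel h1]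
  rw [← mul_nsmul', h5, add_nsmul, h4, zero_add]

/-- A finite set closed under translation by an element of prime order `p` has cardinality
divisible by `p`. -/
theorem dvd_ncard_of_add_mem {p : ℕ} (hp : p.Prime) {w : G} (hw : addOrderOf w = p) {C : Set G}
    [Finite C] (hC : ∀ c ∈ C, c + w ∈ C) : p ∣ C.ncard := by
  have := Fintype.ofFinite C
  have : Fact p.Prime := ⟨hp⟩
  let f : C → C := fun c => ⟨c + w, hC c c.2⟩
  have hf : Function.Injective f := fun c d h => by
    have := congrArg Subtype.val h
    exact Subtype.ext (add_right_cancel this)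
  let σ : Equiv.Perm C := Equiv.ofBijective f (Finite.injective_iff_bijective.1 hf)
  have hσ : ∀ n (c : C), (((σ ^ n) c : C) : G) = c + n • w := by
    intro n
    induction n with
    | zero => simp
    | succ n ih =>
      intro c
      rw [pow_succ', Equiv.Perm.mul_apply]
      change (((σ ^ n) c : C) : G) + w = _
      rw [ih, succ_nsmul, add_assoc]
  have h1 : σ ^ p ^ 1 = 1 := by
    ext c
    rw [pow_one, hσ, ← hw, addOrderOf_nsmul_eq_zero]
    simp
  by_contra hdvd
  rw [← Nat.card_coe_set_eq, Nat.card_eq_fintype_card] at hdvd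
  obtain ⟨c, hc⟩ := Equiv.Perm.exists_fixed_point_of_prime hdvd h1
  have h2 := congrArg Subtype.val hc
  have h3 : (c : G) + w = c := h2
  have h4 : w = 0 := by simpa using h3
  rw [h4, addOrderOf_zero] at hw
  exact hp.ne_one hw.symm

variable {p b : ℕ} {z t w : G}

theorem coprime_addOrderOf_of_prime_pow_nsmul_eq (hp : p.Prime) (hb : b ≠ 0)
    (hz : p ^ b • z = z) : (addOrderOf z).Coprime p := by
  have h1 : (p ^ b - 1) • z = 0 := by
    have h := Nat.sub_add_cancel (Nat.one_le_pow b p hp.pos)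
    have h2 : (p ^ b - 1 + 1) • z = z := by rw [h, hz]
    rwa [succ_nsmul, add_eq_right] at h2
  refine Nat.Coprime.coprime_dvd_left (addOrderOf_dvd_of_nsmul_eq_zero h1) ?_
  refine ((Nat.Prime.coprime_iff_not_dvd hp).2 fun h => hp.one_lt.ne' ?_).symm
  have h3 : p ∣ p ^ b := dvd_pow_self p hb
  have := (Nat.dvd_sub_iff_right (Nat.one_le_pow b p hp.pos) h3).1 h
  exact Nat.dvd_one.1 this

theorem addOrderOf_add_of_prime_pow_nsmul_eq (hp : p.Prime) (hb : b ≠ 0)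
    (hz : p ^ b • z = z) (ht : p ^ b • t = 0) :
    addOrderOf (z + t) = addOrderOf z * addOrderOf t :=
  (AddCommute.all z t).addOrderOf_add_eq_mul_addOrderOf_of_coprime
    (((coprime_addOrderOf_of_prime_pow_nsmul_eq hp hb hz).pow_right b).coprime_dvd_right
      (addOrderOf_dvd_of_nsmul_eq_zero ht))

theorem prime_pow_nsmul_eq_zero (hb : b ≠ 0) (ht : p • t = 0) : p ^ b • t = 0 := by
  obtain ⟨b, rfl⟩ := Nat.exists_eq_succ_of_ne_zero hb
  rw [pow_succ, mul_nsmul', ht, nsmul_zero]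

theorem nsmul_eq_zero_of_addOrderOf_eq (hw : addOrderOf w = p) : p • w = 0 :=
  hw ▸ addOrderOf_nsmul_eq_zero w

theorem addOrderOf_add_eq_addOrderOf_add (hp : p.Prime) (hb : b ≠ 0) (hz : p ^ b • z = z)
    (ht : addOrderOf t = p) (hw : addOrderOf w = p) : addOrderOf (z + t) = addOrderOf (z + w) := by
  rw [addOrderOf_add_of_prime_pow_nsmul_eq hp hb hz
      (prime_pow_nsmul_eq_zero hb (nsmul_eq_zero_of_addOrderOf_eq ht)),
    addOrderOf_add_of_prime_pow_nsmul_eq hp hb hz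
      (prime_pow_nsmul_eq_zero hb (nsmul_eq_zero_of_addOrderOf_eq hw)), ht, hw]

/-- A p-element of order at least p² keeps its order when an element of order p is added. -/
theorem addOrderOf_add_add_eq (hp : p.Prime) (hb : b ≠ 0) (hz : p ^ b • z = z)
    (ht : p ^ b • t = 0) (ht' : p • t ≠ 0) (hw : addOrderOf w = p) :
    addOrderOf (z + t + w) = addOrderOf (z + t) := by
  have : Fact p.Prime := ⟨hp⟩
  have hw' := nsmul_eq_zero_of_addOrderOf_eq hw
  have htw : p ^ b • (t + w) = 0 := by rw [nsmul_add, ht, prime_pow_nsmul_eq_zero hb hw', add_zero]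
  rw [add_assoc, addOrderOf_add_of_prime_pow_nsmul_eq hp hb hz htw,
    addOrderOf_add_of_prime_pow_nsmul_eq hp hb hz ht]
  congr 1
  obtain ⟨j, -, hj⟩ := (Nat.dvd_prime_pow hp).1 (addOrderOf_dvd_of_nsmul_eq_zero ht)
  match j, hj with
  | 0, hj =>
    rw [pow_zero, AddMonoid.addOrderOf_eq_one_iff] at hj
    simp [hj] at ht'
  | 1, hj =>
    rw [pow_one] at hj
    exact absurd (nsmul_eq_zero_of_addOrderOf_eq hj) ht'
  | j + 2, hj =>
    rw [hj]
    refine addOrderOf_eq_prime_pow ?_ ?_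
    · rw [nsmul_add, prime_pow_nsmul_eq_zero (Nat.succ_ne_zero j) hw', add_zero]
      intro h
      have := addOrderOf_dvd_of_nsmul_eq_zero h
      rw [hj, Nat.pow_dvd_pow_iff_le_right hp.one_lt] at this
      omega
    · rw [nsmul_add, prime_pow_nsmul_eq_zero (Nat.succ_ne_zero _) hw', add_zero, ← hj,
        addOrderOf_nsmul_eq_zero]

variable {S : Set G} (hS : ∀ x y, addOrderOf x = addOrderOf y → x ∈ S → y ∈ S)
include hS

/-- Write x = z + t with z the p'-part. If p • t ≠ 0, adding w would not change the order. All z + v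
with v of order p have the same order, so if z agreed with one of them, S would be constant on z +
G[p], which contains x and x + w. -/
theorem not_mem_iff_of_add_notMem (hp : p.Prime) (hb : b ≠ 0)
    (hP : ∀ x : G, p ^ b • p ^ b • x = p ^ b • x) (hw : addOrderOf w = p) {x : G} (hx : x ∈ S)
    (hxw : x + w ∉ S) :
    p • (x - p ^ b • x) = 0 ∧
      ∀ v, addOrderOf v = p → ¬ (p ^ b • x ∈ S ↔ p ^ b • x + v ∈ S) := by
  obtain ⟨t, ht⟩ : ∃ t, x = p ^ b • x + t := ⟨x - p ^ b • x, by abel⟩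
  have hz := hP x
  set z := p ^ b • x with hzdef
  have ht0 : p ^ b • t = 0 := by
    rw [show t = x - z by rw [eq_sub_iff_add_eq', ← ht], nsmul_sub, hz, ← hzdef, sub_self]
  have hxz : x - z = t := by rw [sub_eq_iff_eq_add', ← ht]
  rw [hxz]
  have hpt : p • t = 0 := by
    by_contra h
    refine hxw (hS _ _ ?_ hx)
    rw [ht, addOrderOf_add_add_eq hp hb hz ht0 h hw]
  have : Fact p.Prime := ⟨hp⟩
  refine ⟨hpt, fun v hv h => ?_⟩
  have hiff : ∀ v', addOrderOf v' = p → (z + v ∈ S ↔ z + v' ∈ S) := fun v' hv' =>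
    ⟨hS _ _ (addOrderOf_add_eq_addOrderOf_add hp hb hz hv hv'),
      hS _ _ (addOrderOf_add_eq_addOrderOf_add hp hb hz hv' hv)⟩
  have hiff' : ∀ v', p • v' = 0 → (z ∈ S ↔ z + v' ∈ S) := by
    intro v' hv'
    by_cases h0 : v' = 0
    · rw [h0, add_zero]
    · exact h.trans (hiff v' (addOrderOf_eq_prime hv' h0))
  refine hxw ?_
  rw [ht, add_assoc, ← hiff' (t + w) (by
    rw [nsmul_add, hpt, nsmul_eq_zero_of_addOrderOf_eq hw, add_zero]), hiff' t hpt, ← ht]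
  exact hx

/-- The failures of w-invariance lie in z + G[p], where S contains either z alone or everything but
z. Removing or inserting z makes S ∩ Q invariant, so its size is 1 or -1 modulo p. -/
theorem not_dvd_ncard_inter [Finite G] (hp : p.Prime) (hb : b ≠ 0)
    (hP : ∀ x : G, p ^ b • p ^ b • x = p ^ b • x) (hw : addOrderOf w = p) {Q : Set G}
    (hQ : ∀ x ∈ Q, x + w ∈ Q) (hz : p ^ b • z = z) (hzQ : z ∈ Q) (hzS : ¬ (z ∈ S ↔ z + w ∈ S))
    (hSQ : ∀ x ∈ S ∩ Q, x + w ∉ S → p ^ b • x = z) : ¬ p ∣ (S ∩ Q).ncard := by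
  have : Fact p.Prime := ⟨hp⟩
  have hne : ∀ x ∈ S ∩ Q, x + w ∉ S → x ≠ z → z + w ∈ S := by
    intro x hx hxw hxz
    refine hS _ _ ?_ hx.1
    have h1 := (not_mem_iff_of_add_notMem hS hp hb hP hw hx.1 hxw).1
    rw [hSQ x hx hxw] at h1
    conv_lhs => rw [show x = z + (x - z) by abel]
    exact addOrderOf_add_eq_addOrderOf_add hp hb hz
      (addOrderOf_eq_prime h1 (sub_ne_zero.2 hxz)) hw
  intro hdvd
  by_cases hzmem : z ∈ S
  · have hzw : z + w ∉ S := fun h => hzS ⟨fun _ => h, fun _ => hzmem⟩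
    have hD : p ∣ ((S ∩ Q) \ {z}).ncard := by
      refine dvd_ncard_of_add_mem hp hw fun x hx => ⟨⟨?_, hQ x hx.1.2⟩, ?_⟩
      · by_contra h
        exact hzw (hne x hx.1 h hx.2)
      · intro h
        refine hzw (hS _ _ ?_ hx.1.1)
        rw [show x = z + -w by rw [← Set.mem_singleton_iff.1 h]; abel]
        exact addOrderOf_add_eq_addOrderOf_add hp hb hz (by rw [addOrderOf_neg, hw]) hw
    have h1 := Set.ncard_sdiff_singleton_add_one (s := S ∩ Q) ⟨hzmem, hzQ⟩
    rw [← h1, ← Nat.dvd_add_iff_right hD] at hdvd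
    exact hp.ne_one (Nat.dvd_one.1 hdvd)
  · have hzw : z + w ∈ S := by_contra fun h => hzS ⟨fun h' => absurd h' hzmem, fun h' => absurd h' h⟩
    have hD : p ∣ (insert z (S ∩ Q)).ncard := by
      refine dvd_ncard_of_add_mem hp hw fun x hx => ?_
      rcases hx with rfl | hx
      · exact Or.inr ⟨hzw, hQ _ hzQ⟩
      · by_cases h : x + w ∈ S
        · exact Or.inr ⟨h, hQ _ hx.2⟩
        · left
          have h1 := (not_mem_iff_of_add_notMem hS hp hb hP hw hx.1 h).1
          rw [hSQ x hx h] at h1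
          by_contra h2
          refine h (hS _ _ ?_ hzw)
          rw [show x + w = z + (x - z + w) by abel]
          refine addOrderOf_add_eq_addOrderOf_add hp hb hz hw (addOrderOf_eq_prime ?_ ?_)
          · rw [nsmul_add, h1, nsmul_eq_zero_of_addOrderOf_eq hw, add_zero]
          · intro h3
            apply h2
            rw [← sub_eq_zero, ← h3]
            abel
    rw [Set.ncard_insert_of_notMem (fun h => hzmem h.1), ← Nat.dvd_add_iff_right hdvd] at hD
    exact hp.ne_one (Nat.dvd_one.1 hD)

end OrderClosed

/-! ### Multiplicity sets and minimal saturated subgroups. -/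

namespace IsSchurSetoid

variable {G : Type*} [AddCommGroup G] {r : Setoid G}

/-- The points over which the projection of `S` modulo the `p`-primary component has multiplicity
prime to `p`. -/
def multSet {G : Type*} [AddCommGroup G] (p b : ℕ) (S : Set G) : Set G :=
  {z | ¬ p ∣ {a | a ∈ S ∧ p ^ b • a = z}.ncard}

theorem nsmul_eq_of_mem_multSet {p b : ℕ} {S : Set G}
    (hP : ∀ x : G, p ^ b • p ^ b • x = p ^ b • x) {z : G} (hz : z ∈ multSet p b S) :
    p ^ b • z = z := by
  have : {a | a ∈ S ∧ p ^ b • a = z}.ncard ≠ 0 := fun h => hz (h ▸ dvd_zero p)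
  obtain ⟨a, -, rfl⟩ := Set.nonempty_of_ncard_ne_zero this
  exact hP a

theorem nsmul_eq_of_mem_closure_multSet {p b : ℕ} {S : Set G}
    (hP : ∀ x : G, p ^ b • p ^ b • x = p ^ b • x) {z : G}
    (hz : z ∈ AddSubgroup.closure (multSet p b S)) : p ^ b • z = z := by
  have : AddSubgroup.closure (multSet p b S) ≤
      (nsmulAddMonoidHom (p ^ b) - AddMonoidHom.id G).ker := by
    rw [AddSubgroup.closure_le]
    intro z hz
    simpa [AddMonoidHom.mem_ker, sub_eq_zero] using nsmul_eq_of_mem_multSet hP hz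
  simpa [AddMonoidHom.mem_ker, sub_eq_zero] using this hz

/-- A minimal non-zero saturated subgroup. -/
def _root_.Setoid.IsAtom {G : Type*} [AddCommGroup G] (r : Setoid G) (J : AddSubgroup G) : Prop :=
  Minimal (fun K : AddSubgroup G => r.IsSaturated (K : Set G) ∧ K ≠ ⊥) J

theorem _root_.Setoid.IsAtom.inf_eq_bot {J K : AddSubgroup G} (hJ : r.IsAtom J)
    (hK : r.IsSaturated (K : Set G)) (h : ¬ J ≤ K) : K ⊓ J = ⊥ := by
  by_contra h0
  refine h ((hJ.2 ⟨?_, h0⟩ inf_le_right).trans inf_le_left)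
  rw [AddSubgroup.coe_inf]
  exact hK.inter hJ.1.1

/-- The order of x - y divides both |J| and a number coprime to |J|. -/
theorem eq_of_coprime_addOrderOf {J : AddSubgroup G} {x y : G}
    (hx : (addOrderOf x).Coprime (Nat.card J)) (hy : (addOrderOf y).Coprime (Nat.card J))
    (hxy : x - y ∈ J) : x = y := by
  have h1 : addOrderOf (x - y) ∣ addOrderOf x * addOrderOf y := by
    rw [sub_eq_add_neg, ← addOrderOf_neg y]
    exact (AddCommute.all x (-y)).addOrderOf_add_dvd_mul_addOrderOf
  have h2 : addOrderOf (x - y) ∣ Nat.card J := AddSubgroup.addOrderOf_dvd_natCard J hxy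
  have h3 := Nat.eq_one_of_dvd_coprimes (hx.mul_left hy) h1 h2
  rwa [AddMonoid.addOrderOf_eq_one_iff, sub_eq_zero] at h3

variable [Finite G]

/-- For a common prime q, a multiple of x has order q; K contains some element of order q, hence all
of them, including this multiple. -/
theorem coprime_addOrderOf_card (hr : IsSchurSetoid r) {H K : AddSubgroup G}
    (hK : r.IsSaturated (K : Set G)) (hHK : H ⊓ K = ⊥) {x : G} (hx : x ∈ H) :
    (addOrderOf x).Coprime (Nat.card K) := by
  refine Nat.coprime_of_dvd fun q hq hqx hqK => ?_
  have : Fact q.Prime := ⟨hq⟩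
  obtain ⟨w, hw⟩ := exists_prime_addOrderOf_dvd_card' q hqK
  have h1 : addOrderOf ((addOrderOf x / q) • x) = q :=
    addOrderOf_nsmul_addOrderOf_sub (addOrderOf_pos x).ne' hqx
  have h2 : (addOrderOf x / q) • x ∈ H ⊓ K := by
    refine ⟨nsmul_mem hx _, ?_⟩
    refine hr.mem_of_addOrderOf_eq hK (x := (w : G)) ?_ w.2
    rw [h1, AddSubgroup.addOrderOf_coe, hw]
  rw [hHK, AddSubgroup.mem_bot] at h2
  rw [h2, addOrderOf_zero] at h1
  exact hq.ne_one h1.symm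

theorem isSaturated_multSet (hr : IsSchurSetoid r) {p : ℕ} (hp : p.Prime) (b : ℕ) {S : Set G}
    (hS : r.IsSaturated S) : r.IsSaturated (multSet p b S) := by
  intro x y h hx hdvd
  exact hx ((hr.ncard_nsmul_modEq hp b hS h).dvd_iff dvd_rfl |>.2 hdvd)

variable {J : AddSubgroup G} {p b : ℕ} {w : G}

/-- The subgroup is saturated and multiplication by p^b fixes it pointwise, so it misses w;
minimality of J does the rest. -/
theorem closure_multSet_inf_eq_bot (hr : IsSchurSetoid r) (hJ : r.IsAtom J) (hp : p.Prime)
    (hb : b ≠ 0) (hP : ∀ x : G, p ^ b • p ^ b • x = p ^ b • x) (hw : addOrderOf w = p) (hwJ : w ∈ J)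
    {S : Set G} (hS : r.IsSaturated S) : AddSubgroup.closure (multSet p b S) ⊓ J = ⊥ := by
  refine hJ.inf_eq_bot (hr.isSaturated_closure (hr.isSaturated_multSet hp b hS)) fun hle => ?_
  have h1 := nsmul_eq_of_mem_closure_multSet hP (hle hwJ)
  rw [prime_pow_nsmul_eq_zero hb (nsmul_eq_zero_of_addOrderOf_eq hw)] at h1
  rw [← h1, addOrderOf_zero] at hw
  exact hp.ne_one hw.symm

/-- If a basic set is not invariant under the minimal subgroup `J`, each of its points is congruent
modulo `J` to a point of the multiplicity set, near which the set is not invariant. -/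
theorem exists_mem_multSet (hr : IsSchurSetoid r) (hJ : r.IsAtom J) (hp : p.Prime)
    (hb : b ≠ 0) (hP : ∀ x : G, p ^ b • p ^ b • x = p ^ b • x) (hw : addOrderOf w = p) (hwJ : w ∈ J)
    {x j : G} (hjJ : j ∈ J) (hj : ¬ r x (x + j)) :
    ∃ z, x - z ∈ J ∧ z ∈ multSet p b {y | r x y} ∧ ¬ (r x z ↔ r x (z + w)) := by
  set S : Set G := {y | r x y} with hSdef
  have hS : r.IsSaturated S := r.isSaturated_class x
  have hS' : ∀ x y, addOrderOf x = addOrderOf y → x ∈ S → y ∈ S :=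
    fun x y => hr.mem_of_addOrderOf_eq hS
  have : Fact p.Prime := ⟨hp⟩
  have hpJ : ∀ t, p • t = 0 → t ∈ J := by
    intro t ht
    by_cases h0 : t = 0
    · rw [h0]; exact zero_mem J
    · exact hr.mem_of_addOrderOf_eq hJ.1.1 (hw.trans (addOrderOf_eq_prime ht h0).symm) hwJ
  have hmult : ∀ z, p ^ b • z = z → ¬ (z ∈ S ↔ z + w ∈ S) → z ∈ multSet p b S := by
    intro z hz hzS
    refine not_dvd_ncard_inter (Q := {a | p ^ b • a = z}) hS' hp hb hP hw ?_ hz hz hzS ?_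
    · intro y hy
      change p ^ b • (y + w) = z
      rw [nsmul_add, prime_pow_nsmul_eq_zero hb (nsmul_eq_zero_of_addOrderOf_eq hw), add_zero]
      exact hy
    · intro y hy _
      exact hy.2
  have hnear : ∀ y ∈ S, y + w ∉ S → y - p ^ b • y ∈ J ∧ p ^ b • y ∈ multSet p b S ∧
      ¬ (p ^ b • y ∈ S ↔ p ^ b • y + w ∈ S) := by
    intro y hy hyw
    obtain ⟨h1, h2⟩ := not_mem_iff_of_add_notMem hS' hp hb hP hw hy hyw
    exact ⟨hpJ _ h1, hmult _ (hP y) (h2 w hw), h2 w hw⟩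
  have hcop : ∀ y ∈ multSet p b S, (addOrderOf y).Coprime (Nat.card J) := fun y hy =>
    hr.coprime_addOrderOf_card hJ.1.1 (hr.closure_multSet_inf_eq_bot hJ hp hb hP hw hwJ hS)
      (AddSubgroup.subset_closure hy)
  -- Otherwise the stabilizer of S is a saturated subgroup meeting J in w, hence contains J,
  -- contrary to `hj`.
  obtain ⟨x₀, hx₀, hx₀w⟩ : ∃ x₀ ∈ S, x₀ + w ∉ S := by
    by_contra! h
    have hT := hr.isSaturated_stabilizer hS
    let H : AddSubgroup G :=
      { carrier := {g | ∀ x ∈ S, x + g ∈ S}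
        zero_mem' := fun x hx => by rwa [add_zero]
        add_mem' := fun {a c} ha hc x hx => by
          rw [← add_assoc]
          exact hc _ (ha x hx)
        neg_mem' := fun {a} ha => hT _ _ (hr.neg a) ha }
    have hJH : J ≤ H := by
      by_contra hle
      have h1 : w ∈ H ⊓ J := ⟨h, hwJ⟩
      rw [hJ.inf_eq_bot hT hle, AddSubgroup.mem_bot] at h1
      rw [h1, addOrderOf_zero] at hw
      exact hp.ne_one hw.symm
    exact hj (hJH hjJ x (r.refl' x))
  obtain ⟨hJ₀, hM₀, hiff₀⟩ := hnear x₀ hx₀ hx₀w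
  -- S meets x + J and x₀ + J in equally many points. In x₀ + J all failures of w-invariance have
  -- the same p'-part, because points of the multiplicity set congruent modulo J coincide.
  have hcount : ¬ p ∣ {a | a ∈ S ∧ x - a ∈ J}.ncard := by
    have h1 := hr.ncard_conv hS hJ.1.1 (x := x) (y := x₀) hx₀
    have h2 : {a | a ∈ S ∧ x₀ - a ∈ J} = {a | a ∈ S ∧ p ^ b • x₀ - a ∈ J} := by
      ext a
      refine and_congr_right fun _ => ?_
      rw [← J.add_mem_cancel_left (J.neg_mem hJ₀), show -(x₀ - p ^ b • x₀) + (x₀ - a) =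
        p ^ b • x₀ - a by abel]
    simp only [SetLike.mem_coe] at h1
    rw [h1, h2]
    refine not_dvd_ncard_inter (Q := {a | p ^ b • x₀ - a ∈ J}) hS' hp hb hP hw ?_ (hP x₀) ?_
      hiff₀ ?_
    · intro y hy
      change p ^ b • x₀ - (y + w) ∈ J
      rw [← sub_sub]
      exact J.sub_mem hy hwJ
    · simp
    · intro y hy hyw
      obtain ⟨hJy, hMy, -⟩ := hnear y hy.1 hyw
      refine (eq_of_coprime_addOrderOf (hcop _ hM₀) (hcop _ hMy) ?_).symm
      have := J.add_mem hy.2 hJy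
      rwa [sub_add_sub_cancel] at this
  -- A w-invariant S ∩ (x + J) would have size divisible by p, so invariance already fails inside
  -- the coset of x itself.
  obtain ⟨y, hy, hyJ, hyw⟩ : ∃ y ∈ S, x - y ∈ J ∧ y + w ∉ S := by
    by_contra! h
    refine hcount (dvd_ncard_of_add_mem hp hw fun y hy => ⟨h y hy.1 hy.2, ?_⟩)
    rw [← sub_sub]
    exact J.sub_mem hy.2 hwJ
  obtain ⟨hJy, hMy, hiff⟩ := hnear y hy hyw
  refine ⟨p ^ b • y, ?_, hMy, hiff⟩
  have := J.add_mem hyJ hJy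
  rwa [sub_add_sub_cancel] at this

/-- Inequivalent points congruent modulo a minimal saturated subgroup: one of them lies in a proper
saturated subgroup. -/
theorem exists_ne_top_of_sub_mem (hr : IsSchurSetoid r) (hJ : r.IsAtom J) {x u : G}
    (hxu : x - u ∈ J) (hne : ¬ r x u) :
    ∃ K : AddSubgroup G, r.IsSaturated (K : Set G) ∧ K ≠ ⊤ ∧ (x ∈ K ∨ u ∈ K) := by
  obtain ⟨p, hp, hpJ⟩ := Nat.exists_prime_and_dvd (n := Nat.card J) fun h =>
    hJ.1.2 (AddSubgroup.card_eq_one.1 h)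
  have : Fact p.Prime := ⟨hp⟩
  obtain ⟨⟨w, hwJ⟩, hw⟩ := exists_prime_addOrderOf_dvd_card' p hpJ
  rw [AddSubgroup.addOrderOf_mk] at hw
  obtain ⟨b, hb, hP⟩ := exists_prime_pow_nsmul_nsmul_eq G hp
  obtain ⟨z, hzJ, hzM, hz⟩ := hr.exists_mem_multSet hJ hp hb hP hw hwJ (x := x)
    (j := -(x - u)) (neg_mem hxu) (by rwa [show x + -(x - u) = u by abel])
  obtain ⟨z', hzJ', hzM', hz'⟩ := hr.exists_mem_multSet hJ hp hb hP hw hwJ (x := u)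
    (j := x - u) hxu (by rw [show u + (x - u) = x by abel]; exact fun h => hne (r.symm' h))
  have hbot := fun y => hr.closure_multSet_inf_eq_bot hJ hp hb hP hw hwJ (r.isSaturated_class y)
  have hsat := fun y => hr.isSaturated_multSet hp b (r.isSaturated_class y)
  have hzz : z = z' := by
    refine eq_of_coprime_addOrderOf
      (hr.coprime_addOrderOf_card hJ.1.1 (hbot x) (AddSubgroup.subset_closure hzM))
      (hr.coprime_addOrderOf_card hJ.1.1 (hbot u) (AddSubgroup.subset_closure hzM')) ?_
    have := J.sub_mem (J.add_mem hxu hzJ') hzJ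
    rwa [show x - u + (u - z') - (x - z) = z - z' by abel] at this
  subst hzz
  -- If z lies in the class of y, saturation puts y into the multiplicity set too; the subgroup this
  -- set generates is proper since it meets J trivially.
  have hK : ∀ y, r y z → z ∈ multSet p b {a | r y a} →
      ∃ K : AddSubgroup G, r.IsSaturated (K : Set G) ∧ K ≠ ⊤ ∧ y ∈ K := by
    intro y hy hM
    refine ⟨_, hr.isSaturated_closure (hsat y), fun htop => ?_,
      AddSubgroup.subset_closure (hsat y _ _ (r.symm' hy) hM)⟩
    have h1 := hbot y
    rw [htop, top_inf_eq] at h1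
    exact hJ.1.2 h1
  -- Each of the two classes contains exactly one of z and z + w, and the classes are disjoint, so z
  -- lies in one of them.
  by_cases hxz : r x z
  · obtain ⟨K, h1, h2, h3⟩ := hK x hxz hzM
    exact ⟨K, h1, h2, Or.inl h3⟩
  · have hxzw : r x (z + w) := by
      by_contra h
      exact hz ⟨fun h' => absurd h' hxz, fun h' => absurd h' h⟩
    have huzw : ¬ r u (z + w) := fun h => hne (r.trans' hxzw (r.symm' h))
    have huz : r u z := by
      by_contra h
      exact hz' ⟨fun h' => absurd h' h, fun h' => absurd h' huzw⟩
    obtain ⟨K, h1, h2, h3⟩ := hK u huz hzM'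
    exact ⟨K, h1, h2, Or.inr h3⟩

end IsSchurSetoid

/-! ### Orders in saturated subgroups, restriction and quotients. -/

/-- In a finite abelian group, a subgroup closed under "same order" is closed under
"smaller order". -/
theorem AddSubgroup.mem_of_addOrderOf_dvd {G : Type*} [AddCommGroup G] [Finite G]
    {H : AddSubgroup G} (hH : ∀ x y, addOrderOf x = addOrderOf y → x ∈ H → y ∈ H) {x y : G}
    (hx : x ∈ H) (hxy : addOrderOf y ∣ addOrderOf x) : y ∈ H := by
  suffices key : ∀ n, n ∣ addOrderOf x → ∀ y, addOrderOf y = n → y ∈ H from key _ hxy y rfl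
  intro n
  induction n using Nat.recOnPosPrimePosCoprime with
  | zero => intro _ y hy; exact absurd hy (addOrderOf_pos y).ne'
  | one => intro _ y hy; rw [AddMonoid.addOrderOf_eq_one_iff.1 hy]; exact zero_mem H
  | prime_pow p k hp hk =>
    intro hdvd y hy
    have : Fact p.Prime := ⟨hp⟩
    obtain ⟨K, hK⟩ : ∃ K, ¬ p ^ (K + 1) ∣ addOrderOf x ∧ p ^ K ∣ addOrderOf x :=
      ⟨(addOrderOf x).factorization p, Nat.pow_succ_factorization_not_dvd (addOrderOf_pos x).ne' hp,
        Nat.ordProj_dvd _ _⟩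
    have h1 : addOrderOf ((addOrderOf x / p ^ K) • x) = p ^ K :=
      addOrderOf_nsmul_addOrderOf_sub (addOrderOf_pos x).ne' hK.2
    set x' := (addOrderOf x / p ^ K) • x with hx'
    have hx'H : x' ∈ H := nsmul_mem hx _
    have hkK : k ≤ K := by
      by_contra h
      exact hK.1 ((pow_dvd_pow p (by omega)).trans hdvd)
    rcases hkK.eq_or_lt with rfl | hlt
    · exact hH _ _ (h1.trans hy.symm) hx'H
    -- Since k < K, the sum x' + y again has order p^K; subtracting x' recovers y.
    · have h2 : x' + y ∈ H := by
        refine hH _ _ ?_ hx'H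
        obtain ⟨K, rfl⟩ := Nat.exists_eq_succ_of_ne_zero (by omega : K ≠ 0)
        have hy0 : ∀ l, k ≤ l → p ^ l • y = 0 := fun l hl => by
          rw [← addOrderOf_dvd_iff_nsmul_eq_zero, hy]
          exact pow_dvd_pow p hl
        rw [h1]
        refine (addOrderOf_eq_prime_pow ?_ ?_).symm
        · rw [nsmul_add, hy0 _ (by omega), add_zero, ← addOrderOf_dvd_iff_nsmul_eq_zero, h1,
            Nat.pow_dvd_pow_iff_le_right hp.one_lt]
          omega
        · rw [nsmul_add, hy0 _ (by omega), add_zero, ← addOrderOf_dvd_iff_nsmul_eq_zero, h1]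
      simpa using H.sub_mem h2 hx'H
  | coprime a b _ _ hab iha ihb =>
    intro hdvd y hy
    have h1 : addOrderOf (a • y) = b := by
      have ha : a ∣ addOrderOf y := hy ▸ dvd_mul_right a b
      have ha0 : a ≠ 0 := by rintro rfl; rw [zero_mul] at hy; exact (addOrderOf_pos y).ne' hy
      rw [addOrderOf_nsmul_of_dvd ha0 ha, hy, Nat.mul_div_cancel_left _ (Nat.pos_of_ne_zero ha0)]
    have h2 : addOrderOf (b • y) = a := by
      have hb : b ∣ addOrderOf y := hy ▸ dvd_mul_left b a
      have hb0 : b ≠ 0 := by rintro rfl; rw [mul_zero] at hy; exact (addOrderOf_pos y).ne' hy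
      rw [addOrderOf_nsmul_of_dvd hb0 hb, hy, Nat.mul_div_cancel _ (Nat.pos_of_ne_zero hb0)]
    have h3 := ihb ((dvd_mul_left b a).trans hdvd) _ h1
    have h4 := iha ((dvd_mul_right a b).trans hdvd) _ h2
    have h5 : y = a.gcdA b • a • y + a.gcdB b • b • y := by
      have := Nat.gcd_eq_gcd_ab a b
      rw [hab.gcd_eq_one, Nat.cast_one] at this
      rw [← natCast_zsmul y a, ← natCast_zsmul y b, ← mul_zsmul', ← mul_zsmul', ← add_zsmul,
        ← this, one_zsmul]
    rw [h5]
    exact add_mem (zsmul_mem h3 _) (zsmul_mem h4 _)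

/-- Each coset of `J` contains an element whose order is divisible by the exponent of `J`. -/
theorem AddSubgroup.exists_dvd_addOrderOf {G : Type*} [AddCommGroup G] [Finite G]
    (J : AddSubgroup G) (x : G) :
    ∃ x', x' - x ∈ J ∧ AddMonoid.exponent J ∣ addOrderOf x' := by
  obtain ⟨x', hx', hmax⟩ := Set.exists_max_image {x' | x' - x ∈ J} addOrderOf (Set.toFinite _)
    ⟨x, by simp⟩
  refine ⟨x', hx', (Nat.dvd_iff_prime_pow_dvd_dvd _ _).2 fun p k hp hk => ?_⟩
  have : Fact p.Prime := ⟨hp⟩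
  obtain ⟨j, hj⟩ := AddMonoid.exists_addOrderOf_eq_exponent
    (AddMonoid.ExponentExists.of_finite (G := J))
  have h1 : addOrderOf ((addOrderOf j / p ^ k) • j) = p ^ k :=
    addOrderOf_nsmul_addOrderOf_sub (addOrderOf_pos j).ne' (hj ▸ hk)
  obtain ⟨⟨s, hsJ⟩, hs⟩ : ∃ s : J, addOrderOf s = p ^ k := ⟨_, h1⟩
  rw [AddSubgroup.addOrderOf_mk] at hs
  obtain ⟨b, hb, hP⟩ := exists_prime_pow_nsmul_nsmul_eq G hp
  obtain ⟨t, ht⟩ : ∃ t, x' = p ^ b • x' + t := ⟨x' - p ^ b • x', by abel⟩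
  have hz := hP x'
  set z := p ^ b • x' with hzdef
  have ht0 : p ^ b • t = 0 := by
    rw [show t = x' - z by rw [eq_sub_iff_add_eq', ← ht], nsmul_sub, hz, ← hzdef, sub_self]
  have hs0 : p ^ b • s = 0 := by
    have h2 := (coprime_addOrderOf_of_prime_pow_nsmul_eq hp hb (hP s)).pow_right k
    have h3 : p ^ k • p ^ b • s = 0 := by
      rw [nsmul_left_comm, ← hs, addOrderOf_nsmul_eq_zero, nsmul_zero]
    rw [← AddMonoid.addOrderOf_eq_one_iff]
    exact h2.eq_one_of_dvd (addOrderOf_dvd_of_nsmul_eq_zero h3)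
  by_contra hndvd
  obtain ⟨i, -, hi⟩ := (Nat.dvd_prime_pow hp).1 (addOrderOf_dvd_of_nsmul_eq_zero ht0)
  have hox : addOrderOf x' = addOrderOf z * p ^ i := by
    rw [ht, addOrderOf_add_of_prime_pow_nsmul_eq hp hb hz ht0, hi]
  have hik : i < k := by
    by_contra h
    exact hndvd (hox ▸ (pow_dvd_pow p (by omega)).trans (dvd_mul_left _ _))
  -- The p-part t has smaller order p^i, so adding s from J raises the p-part of the order and
  -- contradicts maximality within the coset.
  have hts : addOrderOf (t + s) = p ^ k := by
    obtain ⟨k, rfl⟩ := Nat.exists_eq_succ_of_ne_zero (by omega : k ≠ 0)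
    have hy0 : ∀ l, i ≤ l → p ^ l • t = 0 := fun l hl => by
      rw [← addOrderOf_dvd_iff_nsmul_eq_zero, hi]
      exact pow_dvd_pow p hl
    refine addOrderOf_eq_prime_pow ?_ ?_
    · rw [nsmul_add, hy0 _ (by omega), zero_add, ← addOrderOf_dvd_iff_nsmul_eq_zero, hs,
        Nat.pow_dvd_pow_iff_le_right hp.one_lt]
      omega
    · rw [nsmul_add, hy0 _ (by omega), zero_add, ← addOrderOf_dvd_iff_nsmul_eq_zero, hs]
  have h2 := hmax (x' + s) (by
    change x' + s - x ∈ J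
    rw [add_sub_right_comm]
    exact add_mem hx' hsJ)
  rw [hox, ht, add_assoc, addOrderOf_add_of_prime_pow_nsmul_eq hp hb hz
    (by rw [nsmul_add, ht0, hs0, add_zero]), hts] at h2
  exact absurd (Nat.le_of_mul_le_mul_left h2 (addOrderOf_pos z))
    (not_le.2 (Nat.pow_lt_pow_right hp.one_lt hik))

namespace IsSchurSetoid

variable {G : Type*} [AddCommGroup G] {r : Setoid G}

/-- The restriction of a Schur partition to a saturated subgroup. -/
theorem comap_subtype (hr : IsSchurSetoid r) {H : AddSubgroup G}
    (hH : r.IsSaturated (H : Set G)) :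
    IsSchurSetoid (r.comap ((↑) : H → G)) where
  eq_zero x hx := Subtype.ext (hr.eq_zero _ hx)
  of_addOrderOf_eq x y hxy := by
    refine hr.of_addOrderOf_eq _ _ ?_
    rw [AddSubgroup.addOrderOf_coe, AddSubgroup.addOrderOf_coe, hxy]
  conv f g hf hg x y hxy := by
    have hext : ∀ (f : H → ℤ), (∀ x y, r.comap ((↑) : H → G) x y → f x = f y) → ∀ x y, r x y →
        Function.extend ((↑) : H → G) f 0 x = Function.extend ((↑) : H → G) f 0 y := by
      intro f hf x y hxy
      by_cases hx : x ∈ H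
      · have hy : y ∈ H := hH x y hxy hx
        have h1 := Subtype.val_injective.extend_apply f (0 : G → ℤ) ⟨x, hx⟩
        have h2 := Subtype.val_injective.extend_apply f (0 : G → ℤ) ⟨y, hy⟩
        exact h1.trans ((hf ⟨x, hx⟩ ⟨y, hy⟩ hxy).trans h2.symm)
      · have hy : y ∉ H := fun hy => hx (hH y x (r.symm' hxy) hy)
        rw [Function.extend_apply' _ _ _ (by rintro ⟨a, rfl⟩; exact hx a.2),
          Function.extend_apply' _ _ _ (by rintro ⟨a, rfl⟩; exact hy a.2)]
        rfl
    have hsum : ∀ z : H, ∑ᶠ a : H, f a * g (z - a) = ∑ᶠ a : G,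
        Function.extend ((↑) : H → G) f 0 a * Function.extend ((↑) : H → G) g 0 (z - a) := by
      intro z
      have h1 : ∀ a : H, f a * g (z - a) = Function.extend ((↑) : H → G) f 0 (a : G) *
          Function.extend ((↑) : H → G) g 0 (z - (a : G)) := by
        intro a
        rw [← AddSubgroup.coe_sub, Subtype.val_injective.extend_apply,
          Subtype.val_injective.extend_apply]
      rw [finsum_congr h1]
      refine (finsum_set_coe_eq_finsum_mem (H : Set G) (f := fun a : G =>
        Function.extend ((↑) : H → G) f 0 a * Function.extend ((↑) : H → G) g 0 (z - a))).trans
        (finsum_congr fun a => ?_)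
      by_cases ha : a ∈ (H : Set G)
      · simp only [ha, finsum_true]
      · rw [Function.extend_apply' _ _ _ (by rintro ⟨c, rfl⟩; exact ha c.2)]
        simp
    rw [hsum, hsum]
    exact hr.conv _ _ (hext f hf) (hext g hg) _ _ hxy

variable [Finite G]

theorem mem_of_addOrderOf_dvd (hr : IsSchurSetoid r) {H : AddSubgroup G}
    (hH : r.IsSaturated (H : Set G)) {x y : G} (hx : x ∈ H)
    (hxy : addOrderOf y ∣ addOrderOf x) : y ∈ H :=
  H.mem_of_addOrderOf_dvd (fun _ _ => hr.mem_of_addOrderOf_eq hH) hx hxy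

/-- The Schur partition of a quotient group. -/
def quotient (hr : IsSchurSetoid r) {J : AddSubgroup G} (hJ : r.IsSaturated (J : Set G)) :
    Setoid (G ⧸ J) where
  r x y := ∃ a b : G, (a : G ⧸ J) = x ∧ (b : G ⧸ J) = y ∧ r a b
  iseqv :=
    { refl := fun x => by
        obtain ⟨a, rfl⟩ := QuotientAddGroup.mk_surjective x
        exact ⟨a, a, rfl, rfl, r.refl' a⟩
      symm := fun ⟨a, b, ha, hb, h⟩ => ⟨b, a, hb, ha, r.symm' h⟩
      trans := by
        rintro _ _ _ ⟨a, b, rfl, rfl, h⟩ ⟨b', c, hb, rfl, h'⟩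
        have hj : -b + b' ∈ J := (QuotientAddGroup.eq.1 hb.symm)
        rw [show b' = b + (-b + b') by abel] at h'
        obtain ⟨b₁, j, hb₁, hj₁, rfl⟩ := hr.exists_add h'
        refine ⟨a, b₁, rfl, ?_, r.trans' h hb₁⟩
        rw [QuotientAddGroup.eq, neg_add_cancel_left]
        exact hJ _ _ hj₁ hj }

/-- J consists of all elements killed by its exponent, because it has an element of that order and
is closed under smaller orders. So n • x ∈ J exactly when n times the exponent kills x. -/
theorem addOrderOf_mk_mul_exponent (hr : IsSchurSetoid r) {J : AddSubgroup G}
    (hJ : r.IsSaturated (J : Set G)) {x : G} (hx : AddMonoid.exponent J ∣ addOrderOf x) :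
    addOrderOf (x : G ⧸ J) * AddMonoid.exponent J = addOrderOf x := by
  obtain ⟨j, hj⟩ := AddMonoid.exists_addOrderOf_eq_exponent
    (AddMonoid.ExponentExists.of_finite (G := J))
  obtain ⟨c, hc⟩ := hx
  have hd : 0 < AddMonoid.exponent J := hj ▸ addOrderOf_pos j
  have key : ∀ n : ℕ, addOrderOf (x : G ⧸ J) ∣ n ↔ c ∣ n := by
    intro n
    rw [addOrderOf_dvd_iff_nsmul_eq_zero, ← QuotientAddGroup.mk_nsmul,
      QuotientAddGroup.eq_zero_iff, ← Nat.mul_dvd_mul_iff_left hd, ← hc,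
      addOrderOf_dvd_iff_nsmul_eq_zero, mul_nsmul']
    constructor
    · intro h
      have := congrArg Subtype.val (AddMonoid.exponent_nsmul_eq_zero (⟨n • x, h⟩ : J))
      simpa using this
    · intro h
      refine hr.mem_of_addOrderOf_dvd hJ j.2 ?_
      rw [AddSubgroup.addOrderOf_coe, hj]
      exact addOrderOf_dvd_of_nsmul_eq_zero h
  rw [hc, mul_comm, Nat.dvd_antisymm ((key c).2 dvd_rfl) ((key _).1 dvd_rfl)]

/-- Cosets of equal order have representatives of equal order, namely those whose order is divisible
by the exponent of J. Convolving functions pulled back from the quotient multiplies the convolution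
there by |J|. -/
theorem isSchurSetoid_quotient (hr : IsSchurSetoid r) {J : AddSubgroup G}
    (hJ : r.IsSaturated (J : Set G)) : IsSchurSetoid (hr.quotient hJ) where
  eq_zero x hx := by
    obtain ⟨a, b, ha, rfl, h⟩ := hx
    rw [QuotientAddGroup.eq_zero_iff] at ha ⊢
    exact hJ _ _ h ha
  of_addOrderOf_eq x y hxy := by
    obtain ⟨a, rfl⟩ := QuotientAddGroup.mk_surjective x
    obtain ⟨b, rfl⟩ := QuotientAddGroup.mk_surjective y
    obtain ⟨a', haJ, ha⟩ := J.exists_dvd_addOrderOf a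
    obtain ⟨b', hbJ, hb⟩ := J.exists_dvd_addOrderOf b
    have ha' : (a' : G ⧸ J) = a := by
      rw [eq_comm, QuotientAddGroup.eq, neg_add_eq_sub]; exact haJ
    have hb' : (b' : G ⧸ J) = b := by
      rw [eq_comm, QuotientAddGroup.eq, neg_add_eq_sub]; exact hbJ
    refine ⟨a', b', ha', hb', hr.of_addOrderOf_eq _ _ ?_⟩
    rw [← hr.addOrderOf_mk_mul_exponent hJ ha, ← hr.addOrderOf_mk_mul_exponent hJ hb, ha', hb', hxy]
  conv f g hf hg x y hxy := by
    classical
    have := Fintype.ofFinite G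
    have := Fintype.ofFinite (G ⧸ J)
    obtain ⟨a, b, rfl, rfl, h⟩ := hxy
    have hmk : ∀ c d, r c d → hr.quotient hJ (c : G ⧸ J) (d : G ⧸ J) :=
      fun c d h => ⟨c, d, rfl, rfl, h⟩
    have h1 := hr.conv (fun c => f c) (fun c => g c) (fun c d h => hf _ _ (hmk c d h))
      (fun c d h => hg _ _ (hmk c d h)) a b h
    have hfib : ∀ q : G ⧸ J, (Finset.univ.filter fun c : G => (c : G ⧸ J) = q).card =
        (Finset.univ.filter fun c : G => (c : G ⧸ J) = 0).card := fun q =>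
      AddMonoidHom.card_fiber_eq_of_mem_range (QuotientAddGroup.mk' J)
        (QuotientAddGroup.mk'_surjective J q) (QuotientAddGroup.mk'_surjective J 0)
    have hsum : ∀ z : G, ∑ᶠ c : G, f c * g ((z - c : G) : G ⧸ J) =
        ((Finset.univ.filter fun c : G => (c : G ⧸ J) = 0).card : ℤ) *
          ∑ᶠ q : G ⧸ J, f q * g (z - q) := by
      intro z
      rw [finsum_eq_sum_of_fintype, finsum_eq_sum_of_fintype,
        ← Finset.sum_fiberwise Finset.univ (fun c : G => (c : G ⧸ J)), Finset.mul_sum]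
      refine Finset.sum_congr rfl fun q _ => ?_
      rw [Finset.sum_congr rfl (g := fun _ => f q * g (z - q)), Finset.sum_const, hfib, nsmul_eq_mul]
      intro c hc
      rw [QuotientAddGroup.mk_sub, (Finset.mem_filter.1 hc).2]
    rw [hsum, hsum] at h1
    refine mul_left_cancel₀ ?_ h1
    rw [Nat.cast_ne_zero, Finset.card_ne_zero]
    exact ⟨0, by simp⟩

/-! ### Classes are determined by the saturated subgroups. -/

theorem _root_.Setoid.exists_isAtom [Nontrivial G] (r : Setoid G) :
    ∃ J : AddSubgroup G, r.IsAtom J := by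
  refine exists_minimal_of_wellFoundedLT _ ⟨⊤, fun _ _ _ _ => trivial, top_ne_bot⟩

theorem rel_of_forall_eq_top {G : Type*} [AddCommGroup G] [Finite G] {r : Setoid G}
    (hr : IsSchurSetoid r) {x u : G}
    (hx : ∀ K : AddSubgroup G, r.IsSaturated (K : Set G) → x ∈ K → K = ⊤)
    (hu : ∀ K : AddSubgroup G, r.IsSaturated (K : Set G) → u ∈ K → K = ⊤) : r x u := by
  induction hn : Nat.card G using Nat.strong_induction_on generalizing G with
  | _ n ih =>
  rcases subsingleton_or_nontrivial G with hG | hG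
  · rw [Subsingleton.elim x u]
  obtain ⟨J, hJ⟩ := r.exists_isAtom
  have hcard : Nat.card (G ⧸ J) < n := by
    rw [← hn, AddSubgroup.card_eq_card_quotient_mul_card_addSubgroup J]
    exact lt_mul_of_one_lt_right Nat.card_pos ((AddSubgroup.one_lt_card_iff_ne_bot J).2 hJ.1.2)
  have hq : ∀ y : G, (∀ K : AddSubgroup G, r.IsSaturated (K : Set G) → y ∈ K → K = ⊤) →
      ∀ K : AddSubgroup (G ⧸ J), (hr.quotient hJ.1.1).IsSaturated (K : Set (G ⧸ J)) →
        (y : G ⧸ J) ∈ K → K = ⊤ := by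
    intro y hy K hK hyK
    have h1 := hy (K.comap (QuotientAddGroup.mk' J))
      (fun a b hab ha => hK _ _ ⟨a, b, rfl, rfl, hab⟩ ha) hyK
    rw [eq_top_iff]
    intro q _
    obtain ⟨a, rfl⟩ := QuotientAddGroup.mk_surjective q
    have h2 : a ∈ K.comap (QuotientAddGroup.mk' J) := h1 ▸ AddSubgroup.mem_top a
    exact h2
  obtain ⟨a, b, ha, hb, hab⟩ := ih _ hcard (hr.isSchurSetoid_quotient hJ.1.1) (hq x hx) (hq u hu) rfl
  rw [eq_comm, QuotientAddGroup.eq] at ha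
  rw [QuotientAddGroup.eq] at hb
  -- Equivalence modulo J only gives representatives a, b of the cosets; splitting a as x plus an
  -- element of J moves x within its class to a point x' congruent to u.
  rw [show a = x + (-x + a) by abel] at hab
  obtain ⟨x', j, hx', hj, rfl⟩ := hr.exists_add hab
  have hxu : x' - u ∈ J := by
    have := J.neg_mem (J.add_mem (hJ.1.1 _ _ hj ha) hb)
    rwa [show -(j + (-(x' + j) + u)) = x' - u by abel] at this
  by_contra hne
  obtain ⟨K, hK, htop, hK'⟩ := hr.exists_ne_top_of_sub_mem hJ hxu
    (fun h => hne (r.trans' hx' h))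
  rcases hK' with h | h
  · exact htop (hx K hK (hK _ _ (r.symm' hx') h))
  · exact htop (hu K hK h)

/-- Points lying in the same saturated subgroups are equivalent. -/
theorem rel_of_forall_mem_iff (hr : IsSchurSetoid r) {x y : G}
    (h : ∀ K : AddSubgroup G, r.IsSaturated (K : Set G) → (x ∈ K ↔ y ∈ K)) : r x y := by
  have hsat := hr.isSaturated_closure (r.isSaturated_class x)
  set H := AddSubgroup.closure {z | r x z}
  have hxH : x ∈ H := AddSubgroup.subset_closure (r.refl' x)
  have hyH : y ∈ H := (h H hsat).1 hxH
  have hmap : ∀ K : AddSubgroup H, (r.comap ((↑) : H → G)).IsSaturated (K : Set H) →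
      r.IsSaturated ((K.map H.subtype : AddSubgroup G) : Set G) := by
    rintro K hK _ b hab ⟨a, ha, rfl⟩
    have hb : b ∈ H := hsat _ _ hab a.2
    exact ⟨⟨b, hb⟩, hK a ⟨b, hb⟩ hab ha, rfl⟩
  -- H is generated by the class of x, so a saturated subgroup of H containing x is all of H; by
  -- hypothesis the same then holds for y.
  have key : ∀ K : AddSubgroup H, (r.comap ((↑) : H → G)).IsSaturated (K : Set H) →
      (⟨x, hxH⟩ : H) ∈ K → K = ⊤ := by
    intro K hK hxK
    have h1 : H ≤ K.map H.subtype := by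
      refine (AddSubgroup.closure_le _).2 fun z hz => ?_
      exact hmap K hK _ _ hz ⟨_, hxK, rfl⟩
    rw [eq_top_iff]
    intro z _
    obtain ⟨z', hz', h2⟩ := h1 z.2
    rwa [← Subtype.ext h2]
  refine (hr.comap_subtype hsat).rel_of_forall_eq_top (x := ⟨x, hxH⟩) (u := ⟨y, hyH⟩) key
    fun K hK hyK => key K hK ?_
  obtain ⟨x', hx', h2⟩ := (h _ (hmap K hK)).2 ⟨_, hyK, rfl⟩
  rwa [← show x' = ⟨x, hxH⟩ from Subtype.ext h2]

end IsSchurSetoid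

/-! ### Additive orders and associates in Galois rings and CG-rings. -/

/-- Non-units are multiples of p, so powers of p can be divided out until a unit remains or p^n = 0
is reached; zero corresponds to j = n. -/
theorem IsGaloisRing.exists_associated_pow {S : Type*} [CommRing S] [IsLocalRing S] {p n : ℕ}
    [CharP S (p ^ n)] (hjac : Ideal.jacobson (⊥ : Ideal S) = Ideal.span {(p : S)}) (x : S) :
    ∃ j ≤ n, Associated ((p : S) ^ j) x := by
  have key : ∀ m ≤ n, (∃ j ≤ n, Associated ((p : S) ^ j) x) ∨ (p : S) ^ m ∣ x := by
    intro m
    induction m with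
    | zero => intro _; simp
    | succ m ih =>
      intro hm
      refine (ih (by omega)).elim Or.inl fun ⟨v, hv⟩ => ?_
      by_cases hu : IsUnit v
      · exact Or.inl ⟨m, by omega, hu.unit, hv.symm⟩
      · right
        have h1 : v ∈ IsLocalRing.maximalIdeal S := hu
        rw [← IsLocalRing.jacobson_eq_maximalIdeal ⊥ bot_ne_top, hjac,
          Ideal.mem_span_singleton] at h1
        rw [hv, pow_succ]
        exact mul_dvd_mul_left _ h1
  refine (key n le_rfl).elim id fun h => ⟨n, le_rfl, ?_⟩
  have h0 : (p : S) ^ n = 0 := by exact_mod_cast CharP.cast_eq_zero S (p ^ n)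
  rw [h0, zero_dvd_iff] at h
  rw [h0, h]

theorem addOrderOf_mul_unit {R : Type*} [CommRing R] (x : R) (u : Rˣ) :
    addOrderOf (x * u) = addOrderOf x :=
  addOrderOf_injective (AddMonoidHom.mulRight (u : R)) (fun _ _ h => u.mul_left_inj.1 h) x

theorem IsGaloisRing.associated_of_addOrderOf_eq {S : Type*} [CommRing S] (hS : IsGaloisRing S)
    {x y : S} (hxy : addOrderOf x = addOrderOf y) : Associated x y := by
  obtain ⟨_, _, p, n, hp, hn, _, hjac⟩ := hS
  obtain ⟨i, hi, u, hx⟩ := exists_associated_pow hjac x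
  obtain ⟨j, hj, v, hy⟩ := exists_associated_pow hjac y
  have hord : ∀ i ≤ n, addOrderOf ((p : S) ^ i) = p ^ (n - i) := by
    intro i hi
    refine Nat.dvd_right_iff_eq.1 fun k => ?_
    rw [addOrderOf_dvd_iff_nsmul_eq_zero, nsmul_eq_mul, ← Nat.cast_pow, ← Nat.cast_mul,
      CharP.cast_eq_zero_iff S (p ^ n)]
    conv_lhs => rw [← Nat.sub_add_cancel hi, pow_add]
    exact Nat.mul_dvd_mul_iff_right (pow_pos hp.pos i)
  have h1 : i = j := by
    rw [← hx, ← hy, addOrderOf_mul_unit, addOrderOf_mul_unit, hord i hi, hord j hj] at hxy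
    have := Nat.pow_right_injective hp.two_le hxy
    omega
  subst h1
  exact (Associated.symm ⟨u, hx⟩).trans ⟨v, hy⟩

/-- In a CG-ring, elements of the same additive order are associated. -/
theorem IsCGRing.associated_of_addOrderOf_eq {R : Type*} [CommRing R] (hR : IsCGRing R)
    {x y : R} (hxy : addOrderOf x = addOrderOf y) : Associated x y := by
  obtain ⟨k, S, _, hS, hcop, ⟨e⟩⟩ := hR
  have hdvd : ∀ x y : R, addOrderOf x = addOrderOf y → ∀ i,
      addOrderOf (e x i) ∣ addOrderOf (e y i) := by
    intro x y hxy i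
    have hchar : ∀ j (a : S j), ringChar (S j) • a = 0 := fun j a => by
      rw [nsmul_eq_mul, CharP.cast_eq_zero, zero_mul]
    -- M kills all components except the i-th and is coprime to the order of that component, so the
    -- i-th order can be read off from the order of the whole element.
    set M := ∏ j ∈ Finset.univ.erase i, ringChar (S j) with hM
    have h1 : addOrderOf (e x i) ∣ addOrderOf x := by
      rw [addOrderOf_dvd_iff_nsmul_eq_zero, ← Pi.smul_apply, ← map_nsmul, addOrderOf_nsmul_eq_zero,
        map_zero, Pi.zero_apply]
    have h2 : addOrderOf y ∣ M * addOrderOf (e y i) := by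
      rw [addOrderOf_dvd_iff_nsmul_eq_zero, ← map_eq_zero_iff e e.injective, map_nsmul]
      ext j
      rw [Pi.smul_apply, Pi.zero_apply]
      by_cases hj : j = i
      · subst hj
        rw [mul_nsmul', addOrderOf_nsmul_eq_zero, nsmul_zero]
      · obtain ⟨c, hc⟩ : ringChar (S j) ∣ M := Finset.dvd_prod_of_mem _ (by simp [hj])
        rw [hc, mul_assoc, mul_nsmul, hchar, nsmul_zero]
    have h3 : (addOrderOf (e x i)).Coprime M := by
      refine Nat.Coprime.coprime_dvd_left (addOrderOf_dvd_of_nsmul_eq_zero (hchar i _)) ?_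
      exact Nat.Coprime.prod_right fun j hj => hcop (Finset.ne_of_mem_erase hj).symm
    exact h3.dvd_of_dvd_mul_left (h1.trans (hxy ▸ h2))
  have hassoc : ∀ i, Associated (e x i) (e y i) := fun i =>
    (hS i).associated_of_addOrderOf_eq (Nat.dvd_antisymm (hdvd x y hxy i) (hdvd y x hxy.symm i))
  choose u hu using hassoc
  refine ⟨Units.mapEquiv e.symm.toMulEquiv (MulEquiv.piUnits.symm u), e.injective ?_⟩
  ext i
  rw [map_mul, Pi.mul_apply, ← hu i]
  simp

/-! ### Dictionary between Schur rings and partitions. -/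

/-- The sums over the classes span the functions constant on classes. -/
theorem span_setSum_classes {G : Type*} [Finite G] (r : Setoid G) (f : AddMonoidAlgebra ℤ G) :
    f ∈ Submodule.span ℤ (setSum '' r.classes) ↔ ∀ x y, r x y → f.coeff x = f.coeff y := by
  classical
  constructor
  · intro hf
    induction hf using Submodule.span_induction with
    | mem f hf =>
      obtain ⟨_, ⟨a, rfl⟩, rfl⟩ := hf
      intro x y hxy
      have : r x a ↔ r y a := ⟨r.trans' (r.symm' hxy), r.trans' hxy⟩
      simp [setSum_apply, this]
    | zero => simp
    | add f g _ _ hf hg => intro x y hxy; simp [hf x y hxy, hg x y hxy]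
    | smul c f _ hf => intro x y hxy; simp [hf x y hxy]
  · intro hf
    have := Fintype.ofFinite (Quotient r)
    have h1 : f = ∑ q : Quotient r, f.coeff q.out • setSum {x | r x q.out} := by
      ext g
      rw [AddMonoidAlgebra.coeff_sum, Finsupp.finsetSum_apply, Finset.sum_eq_single (Quotient.mk r g)]
      · have : r g (Quotient.mk r g).out := r.symm' (Quotient.mk_out g)
        simp [setSum_apply, this, hf _ _ this]
      · intro q _ hq
        have : ¬ r g q.out := fun h => hq (by rw [← q.out_eq]; exact Quotient.sound (r.symm' h))
        simp [setSum_apply, this]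
      · simp
    rw [h1]
    exact Submodule.sum_mem _ fun q _ => Submodule.smul_mem _ _
      (Submodule.subset_span ⟨_, ⟨q.out, rfl⟩, rfl⟩)

namespace SchurRing

variable {G : Type*} [AddCommGroup G] [Finite G]

theorem eq_of_basicSets_eq {A B : SchurRing G} (h : A.basicSets = B.basicSets) : A = B := by
  refine SchurRing.ext (Subalgebra.toSubmodule_injective ?_) h
  rw [← A.span_eq, ← B.span_eq, h]

theorem rank_eq_ncard (A : SchurRing G) : A.rank = A.basicSets.ncard := by
  classical
  have := Fintype.ofFinite (setSum '' A.basicSets : Set (AddMonoidAlgebra ℤ G))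
  have h1 : A.rank = Module.finrank ℤ (Submodule.span ℤ (setSum '' A.basicSets)) := by
    rw [A.span_eq]; rfl
  rw [h1, finrank_span_set_eq_card A.linearIndepOn.id_image, ← Set.ncard_eq_toFinset_card',
    A.linearIndepOn.injOn.ncard_image]

/-- The Schur ring of a Schur partition. -/
def ofSetoid {r : Setoid G} (hr : IsSchurSetoid r) : SchurRing G where
  toSubalgebra :=
    { carrier := {f | ∀ x y, r x y → f.coeff x = f.coeff y}
      mul_mem' := fun {f g} hf hg x y hxy => by
        rw [AddMonoidAlgebra.coeff_mul_eq_finsum, AddMonoidAlgebra.coeff_mul_eq_finsum,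
          hr.conv _ _ hf hg x y hxy]
      add_mem' := fun {f g} hf hg x y hxy => by
        rw [AddMonoidAlgebra.coeff_add, Finsupp.add_apply, Finsupp.add_apply, hf x y hxy,
          hg x y hxy]
      algebraMap_mem' := fun c x y hxy => by
        classical
        have : 0 = x ↔ 0 = y := by
          constructor
          · rintro rfl; exact (hr.eq_zero _ hxy).symm
          · rintro rfl; exact (hr.eq_zero _ (r.symm' hxy)).symm
        change (AddMonoidAlgebra.single 0 (algebraMap ℤ ℤ c)).coeff x =
          (AddMonoidAlgebra.single 0 (algebraMap ℤ ℤ c)).coeff y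
        simp only [AddMonoidAlgebra.coeff_single, Finsupp.single_apply, this] }
  basicSets := r.classes
  nonempty_of_mem := by
    rintro _ ⟨a, rfl⟩
    exact ⟨a, r.refl' a⟩
  pairwiseDisjoint := r.isPartition_classes.pairwiseDisjoint
  singleton_zero_mem := ⟨0, by
    ext x
    rw [Set.mem_singleton_iff]
    exact ⟨fun h => h ▸ r.refl' _, fun h => hr.eq_zero _ (r.symm' h)⟩⟩
  sUnion_eq := r.sUnion_classes
  neg_mem := by
    rintro _ ⟨a, rfl⟩
    refine ⟨a, ?_⟩
    ext x
    have := hr.neg x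
    exact ⟨r.trans' this, r.trans' (r.symm' this)⟩
  linearIndepOn := linearIndepOn_setSum (by rintro _ ⟨a, rfl⟩; exact ⟨a, r.refl' a⟩)
    r.isPartition_classes.pairwiseDisjoint
  span_eq := by
    ext f
    exact span_setSum_classes r f

/-- The partition into basic sets. -/
def setoid (A : SchurRing G) : Setoid G where
  r x y := ∀ X ∈ A.basicSets, x ∈ X ↔ y ∈ X
  iseqv := ⟨fun _ _ _ => Iff.rfl, fun h X hX => (h X hX).symm, fun h h' X hX =>
    (h X hX).trans (h' X hX)⟩

theorem exists_mem_basicSets (A : SchurRing G) (x : G) : ∃ X ∈ A.basicSets, x ∈ X := by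
  have : x ∈ ⋃₀ A.basicSets := A.sUnion_eq ▸ Set.mem_univ x
  exact this

theorem eq_setOf_of_mem (A : SchurRing G) {X : Set G} (hX : X ∈ A.basicSets) {a : G}
    (ha : a ∈ X) : X = {x | A.setoid x a} := by
  ext x
  refine ⟨fun hx Y hY => ?_, fun h => (h X hX).2 ha⟩
  constructor
  · intro hxY
    rwa [A.pairwiseDisjoint.elim_set hY hX x hxY hx]
  · intro haY
    rwa [A.pairwiseDisjoint.elim_set hY hX a haY ha]

theorem basicSets_eq_classes (A : SchurRing G) : A.basicSets = A.setoid.classes := by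
  ext X
  constructor
  · intro hX
    obtain ⟨a, ha⟩ := A.nonempty_of_mem X hX
    exact ⟨a, A.eq_setOf_of_mem hX ha⟩
  · rintro ⟨a, rfl⟩
    obtain ⟨X, hX, ha⟩ := A.exists_mem_basicSets a
    rwa [← A.eq_setOf_of_mem hX ha]

theorem mem_toSubalgebra (A : SchurRing G) (f : AddMonoidAlgebra ℤ G) :
    f ∈ A.toSubalgebra ↔ ∀ x y, A.setoid x y → f.coeff x = f.coeff y := by
  rw [← span_setSum_classes, ← basicSets_eq_classes, A.span_eq]
  rfl

theorem isASet_of_isSaturated (A : SchurRing G) {S : Set G} (hS : A.setoid.IsSaturated S) :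
    A.IsASet S := by
  refine ⟨{X ∈ A.basicSets | X ⊆ S}, fun X hX => hX.1, ?_⟩
  ext x
  constructor
  · intro hx
    obtain ⟨X, hX, hxX⟩ := A.exists_mem_basicSets x
    refine ⟨X, ⟨hX, fun y hy => hS x y ?_ hx⟩, hxX⟩
    rw [A.eq_setOf_of_mem hX hxX] at hy
    exact A.setoid.symm' hy
  · rintro ⟨X, hX, hxX⟩
    exact hX.2 hxX

theorem isSchurSetoid (A : SchurRing G)
    (h : ∀ x y, addOrderOf x = addOrderOf y → A.setoid x y) : IsSchurSetoid A.setoid where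
  eq_zero x hx := (hx _ A.singleton_zero_mem).1 rfl
  of_addOrderOf_eq := h
  conv f g hf hg x y hxy := by
    have key : ∀ f : G → ℤ, (∀ x y, A.setoid x y → f x = f y) →
        AddMonoidAlgebra.ofCoeff (Finsupp.equivFunOnFinite.symm f) ∈ A.toSubalgebra :=
      fun f hf => (A.mem_toSubalgebra _).2 hf
    have h1 := (A.mem_toSubalgebra _).1 (mul_mem (key f hf) (key g hg)) x y hxy
    rw [AddMonoidAlgebra.coeff_mul_eq_finsum, AddMonoidAlgebra.coeff_mul_eq_finsum] at h1
    exact h1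

theorem setoid_of_isRational {R : Type*} [CommRing R] [Finite R] (hR : IsCGRing R)
    {A : SchurRing R} (hA : A.IsRational) {x y : R} (hxy : addOrderOf x = addOrderOf y) :
    A.setoid x y := by
  obtain ⟨u, rfl⟩ := hR.associated_of_addOrderOf_eq hxy
  intro X hX
  conv_rhs => rw [← hA u X hX]
  rw [Set.mem_smul_set_iff_inv_smul_mem, Units.smul_def, smul_eq_mul, mul_comm, mul_assoc,
    Units.mul_inv, mul_one]

end SchurRing

/-! ### The largest saturated subgroup avoiding a minimal one. -/

namespace IsSchurSetoid

variable {G : Type*} [AddCommGroup G] [Finite G] {r : Setoid G}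

/-- For a minimal saturated subgroup `J`, there is a largest saturated subgroup
not containing `J`. -/
theorem exists_isGreatest_not_le (hr : IsSchurSetoid r) {J : AddSubgroup G} (hJ : r.IsAtom J) :
    ∃ I, IsGreatest {K : AddSubgroup G | r.IsSaturated (K : Set G) ∧ ¬ J ≤ K} I := by
  obtain ⟨I, hI⟩ := exists_maximal_of_wellFoundedGT
    (fun K : AddSubgroup G => r.IsSaturated (K : Set G) ∧ ¬ J ≤ K)
    ⟨⊥, hr.isSaturated_bot, fun h => hJ.1.2 (le_bot_iff.1 h)⟩
  refine ⟨I, hI.1, fun K hK => ?_⟩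
  have h1 : r.IsSaturated ((I ⊔ K : AddSubgroup G) : Set G) := hr.isSaturated_sup hI.1.1 hK.1
  -- If w = a + c with a ∈ I, c ∈ K, then a and -c have orders coprime to |J| and differ by w ∈ J,
  -- so they are equal and w = 0.
  by_cases h2 : J ≤ I ⊔ K
  · refine absurd ?_ hJ.1.2
    rw [eq_bot_iff]
    intro w hw
    obtain ⟨a, ha, c, hc, hac⟩ := AddSubgroup.mem_sup.1 (h2 hw)
    have ha' := hr.coprime_addOrderOf_card hJ.1.1 (hJ.inf_eq_bot hI.1.1 hI.1.2) ha
    have hc' := hr.coprime_addOrderOf_card hJ.1.1 (hJ.inf_eq_bot hK.1 hK.2) (K.neg_mem hc)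
    have h3 := eq_of_coprime_addOrderOf ha' hc' (by rwa [sub_neg_eq_add, hac])
    rw [AddSubgroup.mem_bot, ← hac, h3, neg_add_cancel]
  · exact le_sup_right.trans (hI.2 ⟨h1, h2⟩ le_sup_left)

/-- A saturated subgroup through a point outside J + I is not contained in I, hence contains J and
cannot separate x from x + j. -/
theorem rel_add_of_notMem (hr : IsSchurSetoid r) {I J : AddSubgroup G}
    (hI : IsGreatest {K : AddSubgroup G | r.IsSaturated (K : Set G) ∧ ¬ J ≤ K} I) {x j : G}
    (hj : j ∈ J) (hx : x ∉ J ⊔ I) : r x (x + j) := by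
  have key : ∀ K : AddSubgroup G, r.IsSaturated (K : Set G) → ∀ y ∈ K, y ∉ J ⊔ I → J ≤ K := by
    intro K hK y hy hyI
    by_contra h
    exact hyI ((hI.2 ⟨hK, h⟩).trans le_sup_right hy)
  refine hr.rel_of_forall_mem_iff fun K hK => ⟨fun h => ?_, fun h => ?_⟩
  · exact add_mem h (key K hK x h hx hj)
  · refine (K.add_mem_cancel_right (key K hK _ h ?_ hj)).1 h
    rwa [AddSubgroup.add_mem_cancel_right _ (le_sup_left (b := I) hj)]

theorem rel_of_mem_atom (hr : IsSchurSetoid r) {J : AddSubgroup G} (hJ : r.IsAtom J) {x y : G}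
    (hx : x ∈ J) (hy : y ∈ J) (hx0 : x ≠ 0) (hy0 : y ≠ 0) : r x y := by
  have key : ∀ K : AddSubgroup G, r.IsSaturated (K : Set G) → ∀ z ∈ K, z ∈ J → z ≠ 0 → J ≤ K := by
    intro K hK z hzK hzJ hz
    by_contra h
    have h1 : z ∈ K ⊓ J := ⟨hzK, hzJ⟩
    rw [hJ.inf_eq_bot hK h] at h1
    exact hz h1
  exact hr.rel_of_forall_mem_iff fun K hK =>
    ⟨fun h => key K hK x h hx hx0 hy, fun h => key K hK y h hy hy0 hx⟩

/-- Forward, an equivalence of sums lifts to the summands, which are unique because J ∩ I = 0.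
Backward, the orders of a and b are coprime, so both divide the order of a + b, and a saturated
subgroup containing a + b contains a and b. -/
theorem rel_add_iff (hr : IsSchurSetoid r) {I J : AddSubgroup G}
    (hI : r.IsSaturated (I : Set G)) (hJ : r.IsSaturated (J : Set G)) (hJI : J ⊓ I = ⊥)
    {a b c d : G} (ha : a ∈ J) (hb : b ∈ I) (hc : c ∈ J) (hd : d ∈ I) :
    r (c + d) (a + b) ↔ r c a ∧ r d b := by
  constructor
  · intro h
    obtain ⟨c', d', hc', hd', heq⟩ := hr.exists_add h
    have hcJ : c' ∈ J := hJ _ _ hc' hc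
    have hdI : d' ∈ I := hI _ _ hd' hd
    have h1 : a - c' = d' - b := by rw [sub_eq_sub_iff_add_eq_add, heq, add_comm]
    have h2 : a - c' ∈ J ⊓ I := ⟨J.sub_mem ha hcJ, h1 ▸ I.sub_mem hdI hb⟩
    rw [hJI, AddSubgroup.mem_bot] at h2
    rw [h2, eq_comm] at h1
    rw [sub_eq_zero.1 h2, ← sub_eq_zero.1 h1]
    exact ⟨hc', hd'⟩
  · have key : ∀ K : AddSubgroup G, r.IsSaturated (K : Set G) → ∀ a ∈ J, ∀ b ∈ I,
        (a + b ∈ K ↔ a ∈ K ∧ b ∈ K) := by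
      intro K hK a ha b hb
      refine ⟨fun h => ?_, fun h => K.add_mem h.1 h.2⟩
      have h1 : addOrderOf (a + b) = addOrderOf a * addOrderOf b :=
        (AddCommute.all a b).addOrderOf_add_eq_mul_addOrderOf_of_coprime
          (((hr.coprime_addOrderOf_card hI hJI ha).coprime_dvd_right
            (I.addOrderOf_dvd_natCard hb)))
      exact ⟨hr.mem_of_addOrderOf_dvd hK h (h1 ▸ dvd_mul_right _ _),
        hr.mem_of_addOrderOf_dvd hK h (h1 ▸ dvd_mul_left _ _)⟩
    rintro ⟨hca, hdb⟩
    refine hr.rel_of_forall_mem_iff fun K hK => ?_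
    rw [key K hK c hc d hd, key K hK a ha b hb]
    exact and_congr (hK.mem_iff hca) (hK.mem_iff hdb)

/-- Saturated subgroups of the additive group of a ring are ideals. -/
def toIdeal {R : Type*} [CommRing R] [Finite R] {r : Setoid R} (hr : IsSchurSetoid r)
    {H : AddSubgroup R} (hH : r.IsSaturated (H : Set R)) : Ideal R :=
  { H with
    smul_mem' := fun c x hx => hr.mem_of_addOrderOf_dvd hH hx
      (addOrderOf_map_dvd (AddMonoidHom.mulLeft c) x) }

/-- The restriction of a Schur partition to a saturated ideal. -/
theorem comap_coe {R : Type*} [CommRing R] {r : Setoid R} (hr : IsSchurSetoid r)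
    {I : Ideal R} (hI : r.IsSaturated (I : Set R)) : IsSchurSetoid (r.comap ((↑) : I → R)) :=
  hr.comap_subtype (H := I.toAddSubgroup) hI

end IsSchurSetoid

/-! ### The wreath and tensor decompositions. -/

namespace SchurRing

theorem isUnitInvariant_ofSetoid {R M : Type*} [CommRing R] [AddCommGroup M] [Module R M] [Finite M]
    {r : Setoid M} (hr : IsSchurSetoid r) : (ofSetoid hr).IsUnitInvariant R := by
  rintro u _ ⟨a, rfl⟩
  refine ⟨a, ?_⟩
  ext x
  rw [Set.mem_smul_set_iff_inv_smul_mem]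
  have : r (u⁻¹ • x) x := hr.of_addOrderOf_eq _ _
    (addOrderOf_injective (DistribSMul.toAddMonoidHom M u⁻¹) (MulAction.injective u⁻¹) x)
  exact ⟨r.trans' (r.symm' this), r.trans' this⟩

theorem rank_ofSetoid_eq_two {G : Type*} [AddCommGroup G] [Finite G] [Nontrivial G]
    {r : Setoid G} (hr : IsSchurSetoid r) (h : ∀ x y, x ≠ 0 → y ≠ 0 → r x y) :
    (ofSetoid hr).rank = 2 := by
  obtain ⟨a, ha⟩ := exists_ne (0 : G)
  have h0 : ∀ x, r x 0 ↔ x = 0 := fun x =>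
    ⟨fun h => hr.eq_zero _ (r.symm' h), fun h => h ▸ r.refl' _⟩
  have h1 : (ofSetoid hr).basicSets = {{x | r x 0}, {x | r x a}} := by
    ext X
    constructor
    · rintro ⟨b, rfl⟩
      by_cases hb : b = 0
      · left; rw [hb]
      · right
        ext x
        have := h b a hb ha
        exact ⟨fun hx => r.trans' hx this, fun hx => r.trans' hx (r.symm' this)⟩
    · rintro (rfl | rfl)
      exacts [⟨0, rfl⟩, ⟨a, rfl⟩]
  rw [rank_eq_ncard, h1, Set.ncard_pair]
  intro h2
  have h3 : a ∈ {x | r x 0} := h2 ▸ r.refl' a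
  exact ha ((h0 a).1 h3)

variable {R : Type*} [CommRing R] [Finite R]

theorem isNontrivialGenWreath_of_rel {A : SchurRing R} {I J : Ideal R} (hItop : I ≠ ⊤)
    (hJbot : J ≠ ⊥) (hI : A.setoid.IsSaturated (I : Set R)) (hJ : A.setoid.IsSaturated (J : Set R))
    (hJI : J ≤ I) (h : ∀ x ∉ I, ∀ j ∈ J, A.setoid x (x + j)) : A.IsNontrivialGenWreath := by
  refine ⟨I, J, hItop, hJbot, A.isASet_of_isSaturated hI, A.isASet_of_isSaturated hJ,
    fun X hX hXI => le_inf (le_sSup ?_) hJI⟩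
  refine Set.Subset.antisymm ?_ fun x hx => ⟨x, hx, 0, zero_mem _, add_zero x⟩
  rintro _ ⟨x, hx, j, hj, rfl⟩
  exact (h x (hXI hx) j hj X hX).1 hx

theorem eq_tensor_of_rel {A : SchurRing R} {I J : Ideal R} (hJI : IsCompl J I)
    (hI : IsSchurSetoid (A.setoid.comap ((↑) : I → R)))
    (hJ : IsSchurSetoid (A.setoid.comap ((↑) : J → R)))
    (h : ∀ (a c : J) (b d : I), A.setoid ((c : R) + d) (a + b) ↔ A.setoid c a ∧ A.setoid d b) :
    A = tensor (Submodule.prodEquivOfIsCompl J I hJI).toAddEquiv (ofSetoid hJ) (ofSetoid hI) := by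
  have key : ∀ (a : J) (b : I), {x | A.setoid x (a + b)} =
      (Submodule.prodEquivOfIsCompl J I hJI).toAddEquiv ''
        ({x | A.setoid.comap ((↑) : J → R) x a} ×ˢ {x | A.setoid.comap ((↑) : I → R) x b}) := by
    intro a b
    ext x
    obtain ⟨⟨c, d⟩, rfl⟩ := (Submodule.prodEquivOfIsCompl J I hJI).toAddEquiv.surjective x
    rw [(Submodule.prodEquivOfIsCompl J I hJI).toAddEquiv.injective.mem_set_image]
    exact h a c b d
  refine eq_of_basicSets_eq ?_
  rw [basicSets_eq_classes]
  ext X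
  constructor
  · rintro ⟨x, rfl⟩
    obtain ⟨⟨a, b⟩, rfl⟩ := (Submodule.prodEquivOfIsCompl J I hJI).toAddEquiv.surjective x
    exact ⟨_, ⟨a, rfl⟩, _, ⟨b, rfl⟩, key a b⟩
  · rintro ⟨_, ⟨a, rfl⟩, _, ⟨b, rfl⟩, rfl⟩
    exact ⟨_, (key a b).symm⟩

end SchurRing

theorem mainTheorem3 {R : Type*} [CommRing R] [Finite R] [Nontrivial R] (hR : IsCGRing R)
    (A : SchurRing R) (hA : A.IsUnitInvariant R) (hrat : A.IsRational) :
    A.IsNontrivialGenWreath ∨ A.IsTensorWithRankTwo := by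
  have hr := A.isSchurSetoid fun x y => SchurRing.setoid_of_isRational hR hrat
  obtain ⟨J, hJ⟩ := A.setoid.exists_isAtom
  obtain ⟨I, hI⟩ := hr.exists_isGreatest_not_le hJ
  have hIJ := hr.isSaturated_sup hJ.1.1 hI.1.1
  have hbot : J ⊓ I = ⊥ := by rw [inf_comm, hJ.inf_eq_bot hI.1.1 hI.1.2]
  have hJbot : hr.toIdeal hJ.1.1 ≠ ⊥ := by
    intro h
    refine hJ.1.2 (eq_bot_iff.2 fun x hx => ?_)
    have : x ∈ hr.toIdeal hJ.1.1 := hx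
    rwa [h] at this
  -- The sum is direct: all of R gives the tensor product over J and I; a proper ideal J + I serves
  -- as the upper ideal of the wreath product, with J as the lower one.
  by_cases htop : J ⊔ I = ⊤
  · right
    have hcompl : IsCompl (hr.toIdeal hJ.1.1) (hr.toIdeal hI.1.1) := by
      refine IsCompl.of_eq ?_ ?_
      · rw [eq_bot_iff]
        intro x hx
        have : x ∈ J ⊓ I := hx
        rwa [hbot] at this
      · rw [eq_top_iff]
        intro x _
        have hx : x ∈ J ⊔ I := htop ▸ AddSubgroup.mem_top x
        obtain ⟨a, ha, b, hb, rfl⟩ := AddSubgroup.mem_sup.1 hx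
        exact Submodule.add_mem_sup ha hb
    have hJ' := hr.comap_coe (I := hr.toIdeal hJ.1.1) hJ.1.1
    have hI' := hr.comap_coe (I := hr.toIdeal hI.1.1) hI.1.1
    have : Nontrivial (hr.toIdeal hJ.1.1) := Submodule.nontrivial_iff_ne_bot.2 hJbot
    refine ⟨_, _, hcompl, SchurRing.ofSetoid hJ', SchurRing.ofSetoid hI',
      SchurRing.isUnitInvariant_ofSetoid hJ', SchurRing.isUnitInvariant_ofSetoid hI',
      SchurRing.rank_ofSetoid_eq_two hJ' fun x y hx hy => ?_,
      SchurRing.eq_tensor_of_rel hcompl hI' hJ' fun a c b d => ?_⟩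
    · exact hr.rel_of_mem_atom hJ x.2 y.2 (fun h => hx (Subtype.ext h)) fun h => hy (Subtype.ext h)
    · exact hr.rel_add_iff hI.1.1 hJ.1.1 hbot a.2 b.2 c.2 d.2
  · left
    refine SchurRing.isNontrivialGenWreath_of_rel (I := hr.toIdeal hIJ) ?_ hJbot hIJ hJ.1.1
      (fun x hx => le_sup_left (b := I) hx) fun x hx j hj => hr.rel_add_of_notMem hI hj hx
    intro h
    refine htop (eq_top_iff.2 fun x _ => ?_)
    have : x ∈ hr.toIdeal hIJ := h ▸ Submodule.mem_top
    exact this
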